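/- **Setting.** Let $f,\phi:\mathbb{R}^n\to\mathbb{R}$ and $F=f+\phi$. Let $N\ge 1$ and let $U=[U_1,\dots,U_N]$ be a column permutation of the identity matrix $I_n$, split into blocks $U_i\in\mathbb{R}^{n\times n_i}$ with $\sum_i n_i=n$. Assume: 1. $f$ and $\phi$ are continuously differentiable; $\nabla f$ is Lipschitz continuous on $\mathbb{R}^n$, and $\nabla\phi$ is Lipschitz continuous on every compact set; 2. for all $x\in\mathbb{R}^n$ and $i=1,\dots,N$ the function $\phi_i^x(z)=\phi(x+U_i(z-U_i^Tx))$, $z\in\mathbb{R}^{n_i}$, is convex; 3. $F$ is bounded from below. **Algorithm (Block-PHILA).** Fix $0<\alpha_{\min}\le\alpha_{\max}$, $\beta_{\max}>0$, $\mu>0$, $\tau\ge0$, $\gamma>0$, $\delta,\sigma\in(0,1)$, $x_0\in\mathbb{R}^n$ and set $x_{-1}=\dots=x_{-N}=x_0$. For $k=0,1,2,\dots$ let $i_k=(k \bmod N)+1$, choose $\alpha_k\in[\alpha_{\min},\alpha_{\max}]$, $\beta_k\in[0,\beta_{\max}]$ and a symmetric positive definite $D_k$ of order $n_{i_k}$ with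 $\frac1\mu I\preceq D_k\preceq\mu I$, and put $$h_k(y)=\Big\langle U_{i_k}^T\nabla f(x_k)-\tfrac{\beta_k}{\alpha_k}D_kU_{i_k}^T(x_k-x_{k-N}),\,y-U_{i_k}^Tx_k\Big\rangle+\tfrac1{2\alpha_k}\|y-U_{i_k}^Tx_k\|_{D_k}^2+\phi_{i_k}^{x_k}(y)-\phi_{i_k}^{x_k}(U_{i_k}^Tx_k),$$ where $\|v\|_D^2=\langle v,Dv\rangle$. Let $$\hat y_k=\operatorname{argmin}_y\ \tfrac12\big\|y-U_{i_k}^T(x_k+\beta_k(x_k-x_{k-N}))+\alpha_kD_k^{-1}U_{i_k}^T\nabla f(x_k)\big\|_{D_k}^2+\alpha_k\phi_{i_k}^{x_k}(y),$$ let $\tilde y_k$ be any point with $h_k(\tilde y_k)\le\frac{2}{2+\tau}h_k(\hat y_k)$, and let $d_k=\tilde y_k-U_{i_k}^Tx_k$. Let $m_k$ be the smallest non-negative integer such that $$F(x_k+\delta^{m_k}U_{i_k}d_k)+\tfrac\gamma2\|\delta^{m_k}d_k\|^2\le F(x_k)+\tfrac\gamma2\|U_{i_k}^T(x_k-x_{k-N})\|^2+\sigma\delta^{m_k}h_k(\tilde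 y_k),$$ and let $\lambda_k=\delta^{m_k}$. Set $x_{k+1}=x_k+U_{i_k}d_k$ if $F(x_k+U_{i_k}d_k)+\frac\gamma2\|d_k\|^2<F(x_k+\lambda_kU_{i_k}d_k)+\frac\gamma2\lambda_k^2\|d_k\|^2$, and $x_{k+1}=x_k+\lambda_kU_{i_k}d_k$ otherwise. **KL inequality.** A continuously differentiable function $G$ on a Euclidean space satisfies the KL inequality at $z$ with $\xi$ if there are $\nu>0$ and a neighbourhood $V$ of $z$ such that $\xi:[0,\nu)\to[0,\infty)$ is continuous and concave, $\xi(0)=0$, $\xi\in C^1((0,\nu))$, $\xi'>0$ on $(0,\nu)$, and $\xi'(G(y)-G(z))\,\|\nabla G(y)\|\ge1$ for all $y\in V$ with $G(z)<G(y)<G(z)+\nu$. It is a KL function if at every point it satisfies the KL inequality with some $\xi$. **Theorem.** In this setting, let $(x_k)$ be a bounded sequence generated by the algorithm, assume that $(x,\rho)\mapsto F(x)+\frac12\rho^2$ is a KL function on $\mathbb{R}^n\times\mathbb{R}$, and let $x^*$ be a limit point of $(x_k)$. Suppose that the merit function $$\Psi(z_1,\dots,z_{N+1})=F(z_1)+\frac\gamma2\sum_{i=1}^N\|z_i-z_{i+1}\|^2,\qquad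 z_1,\dots,z_{N+1}\in\mathbb{R}^n,$$ satisfies the KL inequality at $(x^*,\dots,x^*)$ with $\xi(t)=c\,t^{1-\theta}$, where $c>0$ and $\theta\in[0,1)$. Then $x_k\to x^*$ (so $x^*$ is the unique limit point), and: (i) if $\theta=0$, the sequence terminates in finitely many iterations: there is $K$ with $x_k=x^*$ for all $k\ge K$; (ii) if $\theta\in(0,\frac12]$, there exist $C>0$ and $\omega\in(0,1)$ such that $F(x_{kN})-F(x^*)\le C\omega^k$ for all $k\ge0$; (iii) if $\theta\in(\frac12,1)$, there exists $C>0$ such that $F(x_{kN})-F(x^*)\le C\,k^{-\frac1{2\theta-1}}$ for all $k\ge1$. -/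

import Mathlib

open Filter Topology

noncomputable section

namespace BlockPHILA

/-- Euclidean space of dimension `n`, with the Euclidean norm and inner product. -/
abbrev Vec (n : ℕ) : Type := EuclideanSpace ℝ (Fin n)

/-- The matrix-vector product between Euclidean spaces. -/
def mulE {a b : ℕ} (A : Matrix (Fin a) (Fin b) ℝ) (v : Vec b) : Vec a :=
  WithLp.toLp 2 (A.mulVec v.ofLp)

/-- The square `‖v‖_D² = ⟨v, D v⟩` of the norm induced by `D`. -/
def sqNormD {a : ℕ} (D : Matrix (Fin a) (Fin a) ℝ) (v : Vec a) : ℝ :=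
  inner ℝ v (mulE D v)

/-- The set of minimum points of `y ↦ (1/2) ‖y - v‖_D² + α φ(y)`, that is, the (set-valued)
proximal operator of `α φ` at `v` with respect to the norm induced by `D`. -/
def proxD {a : ℕ} (D : Matrix (Fin a) (Fin a) ℝ) (α : ℝ) (φ : Vec a → ℝ) (v : Vec a) :
    Set (Vec a) :=
  {y | ∀ z : Vec a,
    (1 / 2) * sqNormD D (y - v) + α * φ y ≤ (1 / 2) * sqNormD D (z - v) + α * φ z}

/-! ### The Kurdyka-Łojasiewicz inequality -/

/-- `ξ` restricts to a continuous concave function `[0, ν) → [0, ∞)` with `ξ 0 = 0` that is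
continuously differentiable with positive derivative on `(0, ν)`. -/
structure IsDesingularizing (ξ : ℝ → ℝ) (ν : ℝ) : Prop where
  continuousOn : ContinuousOn ξ (Set.Ico 0 ν)
  concaveOn : ConcaveOn ℝ (Set.Ico 0 ν) ξ
  nonneg : ∀ s ∈ Set.Ico 0 ν, 0 ≤ ξ s
  map_zero : ξ 0 = 0
  contDiffOn : ContDiffOn ℝ 1 ξ (Set.Ioo 0 ν)
  deriv_pos : ∀ s ∈ Set.Ioo 0 ν, 0 < deriv ξ s

/-- The (continuously differentiable) function `G` satisfies the KL inequality at `z` with the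
function `ξ`. -/
def KLAtWith {E : Type*} [NormedAddCommGroup E] [InnerProductSpace ℝ E] [CompleteSpace E]
    (G : E → ℝ) (z : E) (ξ : ℝ → ℝ) : Prop :=
  ∃ ν : ℝ, 0 < ν ∧ IsDesingularizing ξ ν ∧ ∃ V ∈ 𝓝 z, ∀ y ∈ V, G z < G y → G y < G z + ν →
    1 ≤ deriv ξ (G y - G z) * ‖gradient G y‖

/-- `G` is a KL function: it satisfies the KL inequality at every point, for some `ξ` that may
depend on the point. -/
def IsKLFunction {E : Type*} [NormedAddCommGroup E] [InnerProductSpace ℝ E] [CompleteSpace E]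
    (G : E → ℝ) : Prop :=
  ∀ z : E, ∃ ξ : ℝ → ℝ, KLAtWith G z ξ

/-! ### Blocks of coordinates -/

/-- A distribution of the `n` coordinates into `N` blocks, block `i` having `size i` coordinates;
`perm ⟨i, c⟩` is the coordinate that is listed at place `c` of block `i`. -/
structure Blocks (n N : ℕ) where
  size : Fin N → ℕ
  perm : (Σ i : Fin N, Fin (size i)) ≃ Fin n

/-- The matrix `U_i`: the columns of the identity matrix with the indices in block `i`. All these
matrices side by side form a column permutation `U = [U_1, …, U_N]` of the identity. -/
def Blocks.U {n N : ℕ} (B : Blocks n N) (i : Fin N) : Matrix (Fin n) (Fin (B.size i)) ℝ :=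
  (1 : Matrix (Fin n) (Fin n) ℝ).submatrix id (fun c => B.perm ⟨i, c⟩)

/-- `U_i v`. -/
def Blocks.embed {n N : ℕ} (B : Blocks n N) (i : Fin N) (v : Vec (B.size i)) : Vec n :=
  mulE (B.U i) v

/-- `U_iᵀ x`, the `i`-th block of coordinates of `x`. -/
def Blocks.proj {n N : ℕ} (B : Blocks n N) (i : Fin N) (x : Vec n) : Vec (B.size i) :=
  mulE (B.U i).transpose x

/-- The restriction `φ_i^x(z) = φ(x + U_i (z - U_iᵀ x))` of `φ` to block `i`. -/
def Blocks.restrict {n N : ℕ} (B : Blocks n N) (φ : Vec n → ℝ) (i : Fin N) (x : Vec n)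
    (z : Vec (B.size i)) : ℝ :=
  φ (x + B.embed i (z - B.proj i x))

/-! ### The algorithm -/

/-- The parameters of the algorithm. -/
structure Params where
  αmin : ℝ
  αmax : ℝ
  βmax : ℝ
  μ : ℝ
  τ : ℝ
  γ : ℝ
  δ : ℝ
  σ : ℝ
  αmin_pos : 0 < αmin
  αmin_le : αmin ≤ αmax
  βmax_pos : 0 < βmax
  μ_pos : 0 < μ
  τ_nonneg : 0 ≤ τ
  γ_pos : 0 < γ
  δ_pos : 0 < δ
  δ_lt_one : δ < 1
  σ_pos : 0 < σ
  σ_lt_one : σ < 1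

/-- The block index used at iteration `k`: the blocks are indexed by `0, …, N - 1` and visited
cyclically. -/
def blockIdx (N : ℕ) [NeZero N] (k : ℕ) : Fin N := Fin.ofNat N k

/-- The iterate `x_{k-N}`, with the convention `x_{-1} = ⋯ = x_{-N} = x_0`. -/
def lagged {n : ℕ} (N : ℕ) (x : ℕ → Vec n) (k : ℕ) : Vec n :=
  if N ≤ k then x (k - N) else x 0

/-- The function
`h(y) = ⟨U_iᵀ ∇f(x) - (β/α) D U_iᵀ (x - w), y - U_iᵀ x⟩ + (1/(2α)) ‖y - U_iᵀ x‖_D²`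
`+ φ_i^x(y) - φ_i^x(U_iᵀ x)`. -/
def hFun {n N : ℕ} (B : Blocks n N) (f φ : Vec n → ℝ) (i : Fin N) (α β : ℝ)
    (D : Matrix (Fin (B.size i)) (Fin (B.size i)) ℝ) (x w : Vec n) (y : Vec (B.size i)) : ℝ :=
  inner ℝ (B.proj i (gradient f x) - (β / α) • mulE D (B.proj i (x - w))) (y - B.proj i x)
    + 1 / (2 * α) * sqNormD D (y - B.proj i x)
    + B.restrict φ i x y - B.restrict φ i x (B.proj i x)

/-- `y` is a `τ`-approximation of the inertial proximal-gradient point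
`prox^D_{α φ_i^x}(U_iᵀ (x + β (x - w)) - α D⁻¹ U_iᵀ ∇f(x))` on block `i`. -/
def IsApproxProx {n N : ℕ} (B : Blocks n N) (f φ : Vec n → ℝ) (τ : ℝ) (i : Fin N) (α β : ℝ)
    (D : Matrix (Fin (B.size i)) (Fin (B.size i)) ℝ) (x w : Vec n) (y : Vec (B.size i)) : Prop :=
  ∃ yhat ∈ proxD D α (B.restrict φ i x)
      (B.proj i (x + β • (x - w)) - α • mulE D⁻¹ (B.proj i (gradient f x))),
    hFun B f φ i α β D x w y ≤ 2 / (2 + τ) * hFun B f φ i α β D x w yhat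

/-- The Armijo-like line-search condition at the step `lam`, along the direction `d` in block `i`,
where `hval` is the value of `h` at the approximate proximal-gradient point. -/
def Armijo {n N : ℕ} (B : Blocks n N) (F : Vec n → ℝ) (γ σ : ℝ) (i : Fin N)
    (x w : Vec n) (d : Vec (B.size i)) (hval lam : ℝ) : Prop :=
  F (x + lam • B.embed i d) + γ / 2 * ‖lam • d‖ ^ 2 ≤
    F x + γ / 2 * ‖B.proj i (x - w)‖ ^ 2 + σ * lam * hval

open Classical in
/-- The final step: the full step is taken if it gives a smaller value of the merit function than
the step `lam`. -/
def nextIterate {n N : ℕ} (B : Blocks n N) (F : Vec n → ℝ) (γ : ℝ) (i : Fin N)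
    (x : Vec n) (d : Vec (B.size i)) (lam : ℝ) : Vec n :=
  if F (x + B.embed i d) + γ / 2 * ‖d‖ ^ 2 <
      F (x + lam • B.embed i d) + γ / 2 * lam ^ 2 * ‖d‖ ^ 2 then
    x + B.embed i d
  else
    x + lam • B.embed i d

/-- The sequence `x` is generated by Block-PHILA for the objective `f + φ`, with steplengths
`α k`, inertial parameters `β k`, scaling matrices `D k`, approximate proximal-gradient points
`ytil k` and line-search exponents `m k`. -/
structure IsRun {n N : ℕ} [NeZero N] (B : Blocks n N) (p : Params) (f φ : Vec n → ℝ)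
    (x : ℕ → Vec n) (α β : ℕ → ℝ)
    (D : (k : ℕ) →
      Matrix (Fin (B.size (blockIdx N k))) (Fin (B.size (blockIdx N k))) ℝ)
    (ytil : (k : ℕ) → Vec (B.size (blockIdx N k))) (m : ℕ → ℕ) : Prop where
  α_mem : ∀ k, α k ∈ Set.Icc p.αmin p.αmax
  β_mem : ∀ k, β k ∈ Set.Icc 0 p.βmax
  D_posDef : ∀ k, (D k).PosDef
  D_lower : ∀ k v, 1 / p.μ * ‖v‖ ^ 2 ≤ sqNormD (D k) v
  D_upper : ∀ k v, sqNormD (D k) v ≤ p.μ * ‖v‖ ^ 2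
  approx : ∀ k, IsApproxProx B f φ p.τ (blockIdx N k) (α k) (β k) (D k) (x k) (lagged N x k)
    (ytil k)
  lineSearch : ∀ k, IsLeast
    {j : ℕ | Armijo B (fun z => f z + φ z) p.γ p.σ (blockIdx N k) (x k) (lagged N x k)
      (ytil k - B.proj (blockIdx N k) (x k))
      (hFun B f φ (blockIdx N k) (α k) (β k) (D k) (x k) (lagged N x k) (ytil k))
      (p.δ ^ j)}
    (m k)
  step : ∀ k, x (k + 1) = nextIterate B (fun z => f z + φ z) p.γ (blockIdx N k) (x k)
    (ytil k - B.proj (blockIdx N k) (x k)) (p.δ ^ m k)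

/-! ### Merit functions -/

/-- `Ψ(z_1, …, z_{N+1}) = F(z_1) + (γ/2) ∑_{i=1}^N ‖z_i - z_{i+1}‖²` on the product of `N + 1`
copies of the Euclidean space, with the Euclidean structure of the product. -/
def merit {n : ℕ} (N : ℕ) (γ : ℝ) (F : Vec n → ℝ)
    (z : PiLp 2 (fun _ : Fin (N + 1) => Vec n)) : ℝ :=
  F (z 0) + γ / 2 * ∑ i : Fin N, ‖z i.castSucc - z i.succ‖ ^ 2

/-- The point `(v, …, v)`. -/
def diagPt {n : ℕ} (N : ℕ) (v : Vec n) : PiLp 2 (fun _ : Fin (N + 1) => Vec n) :=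
  WithLp.toLp 2 (fun _ => v)

/-- `(x, ρ) ↦ F(x) + ρ²/2` on the Euclidean product of the Euclidean space with `ℝ`. -/
def liftSq {n : ℕ} (F : Vec n → ℝ) (z : WithLp 2 (Vec n × ℝ)) : ℝ :=
  F z.fst + 1 / 2 * z.snd ^ 2

end BlockPHILA

end

/-! Write `H k` for `-h_k(ỹ_k)`. Convexity on a block makes `h_k` grow quadratically around its
minimizer `ŷ_k`, so `H k` is nonnegative and bounds the squared distances from `ŷ_k` to the current
block and to `ỹ_k`. The line-search steps stay above a positive constant, so each iteration lowers
`F` by a multiple of `H k`, up to inertial terms (`exists_step_estimates`). A block moves only once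
in `N` consecutive iterations, so the inertial displacement at iteration `k + N` has the length of
the step made at `k` (`norm_proj_sub_lagged`). The inertial terms therefore telescope, and `Ψ` at `N
+ 1` consecutive iterates decreases.

Sampled once per cycle, `Ψ` equals `F(x*) + e k` with `e` decreasing to `0`. Optimality of `ŷ_k`
bounds one partial gradient of `F` per iteration, and a full cycle assembles the whole gradient;
hence the steps and `∇Ψ` are bounded by square roots of decrements of `e` (`exists_energy`). Near
`x*` the KL inequality becomes `1 ≤ ξ'(e (k+2)) M (√(e (k+1) - e (k+2)) + √(e k - e (k+1)))`.
Concavity of `ξ` turns it into a Lyapunov function whose decrease dominates the steps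
(`exists_lyapunov_of_kl`); as `x*` is a cluster point, the iterates are trapped near it and converge
(`tendsto_of_lyapunov`).

For `ξ(t) = c t^(1-θ)`, squaring gives `e (k+2) ^ (2θ) ≤ M' (e k - e (k+2))` whenever `e (k+2) > 0`.
The three rates are the behaviours of this scalar recurrence for exponent `0`, in `(0, 1]` and above
`1`. -/

namespace BlockPHILA

/-! ### Matrix-vector products -/

/-- `mulE A` as a continuous linear map. -/
noncomputable def mulECLM {a b : ℕ} (A : Matrix (Fin a) (Fin b) ℝ) : Vec b →L[ℝ] Vec a :=
  LinearMap.toContinuousLinearMap (Matrix.toEuclideanLin A)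

theorem mulECLM_apply {a b : ℕ} (A : Matrix (Fin a) (Fin b) ℝ) (v : Vec b) :
    mulECLM A v = mulE A v := rfl

theorem mulE_add {a b : ℕ} (A : Matrix (Fin a) (Fin b) ℝ) (v w : Vec b) :
    mulE A (v + w) = mulE A v + mulE A w := map_add (mulECLM A) v w

theorem mulE_sub {a b : ℕ} (A : Matrix (Fin a) (Fin b) ℝ) (v w : Vec b) :
    mulE A (v - w) = mulE A v - mulE A w := map_sub (mulECLM A) v w

theorem mulE_smul {a b : ℕ} (A : Matrix (Fin a) (Fin b) ℝ) (r : ℝ) (v : Vec b) :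
    mulE A (r • v) = r • mulE A v := map_smul (mulECLM A) r v

theorem mulE_zero {a b : ℕ} (A : Matrix (Fin a) (Fin b) ℝ) : mulE A 0 = 0 :=
  map_zero (mulECLM A)

theorem mulE_mul {a b c : ℕ} (A : Matrix (Fin a) (Fin b) ℝ) (A' : Matrix (Fin b) (Fin c) ℝ)
    (v : Vec c) : mulE (A * A') v = mulE A (mulE A' v) := by
  simp [mulE, Matrix.mulVec_mulVec]

theorem mulE_one {a : ℕ} (v : Vec a) : mulE (1 : Matrix (Fin a) (Fin a) ℝ) v = v := by
  simp [mulE]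

theorem inner_mulE_left {a b : ℕ} (A : Matrix (Fin a) (Fin b) ℝ) (v : Vec b) (w : Vec a) :
    inner ℝ (mulE A v) w = inner ℝ v (mulE A.transpose w) := by
  simp only [EuclideanSpace.inner_eq_star_dotProduct, mulE, star_trivial]
  rw [Matrix.dotProduct_mulVec, Matrix.mulVec_transpose]

/-! ### Block projections and embeddings -/

namespace Blocks

variable {n N : ℕ} (B : Blocks n N) (i : Fin N)

theorem proj_apply (x : Vec n) (c : Fin (B.size i)) : B.proj i x c = x (B.perm ⟨i, c⟩) := by
  simp [proj, mulE, U, Matrix.mulVec, dotProduct, Matrix.one_apply]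

theorem inner_embed (v : Vec (B.size i)) (x : Vec n) :
    inner ℝ (B.embed i v) x = inner ℝ v (B.proj i x) := inner_mulE_left _ _ _

theorem proj_embed (v : Vec (B.size i)) : B.proj i (B.embed i v) = v := by
  ext c
  rw [proj_apply]
  simp [embed, mulE, U, Matrix.mulVec, dotProduct, Matrix.one_apply]

theorem proj_embed_of_ne {i j : Fin N} (hij : i ≠ j) (v : Vec (B.size i)) :
    B.proj j (B.embed i v) = 0 := by
  ext c
  rw [proj_apply]
  simp only [embed, mulE, U, Matrix.mulVec, dotProduct, Matrix.submatrix_apply, id,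
    Matrix.one_apply, EmbeddingLike.apply_eq_iff_eq, Sigma.mk.injEq, PiLp.zero_apply]
  refine Finset.sum_eq_zero fun d _ => ?_
  rw [if_neg (fun h => hij (congrArg Sigma.fst (B.perm.injective h)).symm), zero_mul]

theorem norm_embed (v : Vec (B.size i)) : ‖B.embed i v‖ = ‖v‖ := by
  have h : inner ℝ (B.embed i v) (B.embed i v) = inner ℝ v v := by
    rw [inner_embed, proj_embed]
  rw [real_inner_self_eq_norm_sq, real_inner_self_eq_norm_sq] at h
  exact (sq_eq_sq₀ (norm_nonneg _) (norm_nonneg _)).1 h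

theorem sum_sq_norm_proj (x : Vec n) : ∑ i, ‖B.proj i x‖ ^ 2 = ‖x‖ ^ 2 := by
  simp only [EuclideanSpace.norm_sq_eq, proj_apply]
  rw [← Fintype.sum_sigma' (fun i c => ‖x (B.perm ⟨i, c⟩)‖ ^ 2)]
  exact Equiv.sum_comp B.perm (fun a => ‖x a‖ ^ 2)

theorem norm_proj_le (x : Vec n) : ‖B.proj i x‖ ≤ ‖x‖ := by
  refine (sq_le_sq₀ (norm_nonneg _) (norm_nonneg _)).1 ?_
  rw [← B.sum_sq_norm_proj x]
  exact Finset.single_le_sum (f := fun i => ‖B.proj i x‖ ^ 2) (fun _ _ => sq_nonneg _)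
    (Finset.mem_univ i)

theorem norm_le_of_proj_le (x : Vec n) {r : ℝ} (hr : 0 ≤ r) (h : ∀ i, ‖B.proj i x‖ ≤ r) :
    ‖x‖ ≤ N * r := by
  refine (sq_le_sq₀ (norm_nonneg _) (by positivity)).1 ?_
  rw [← B.sum_sq_norm_proj x]
  calc ∑ i, ‖B.proj i x‖ ^ 2 ≤ ∑ _i : Fin N, r ^ 2 :=
        Finset.sum_le_sum fun i _ => pow_le_pow_left₀ (norm_nonneg _) (h i) 2
    _ = N * r ^ 2 := by simp
    _ ≤ (N * r) ^ 2 := by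
        have : (N : ℝ) ≤ (N : ℝ) ^ 2 := by exact_mod_cast Nat.le_self_pow two_ne_zero N
        rw [mul_pow]
        gcongr

theorem proj_add (x y : Vec n) : B.proj i (x + y) = B.proj i x + B.proj i y := mulE_add _ _ _
theorem proj_sub (x y : Vec n) : B.proj i (x - y) = B.proj i x - B.proj i y := mulE_sub _ _ _
theorem proj_smul (r : ℝ) (x : Vec n) : B.proj i (r • x) = r • B.proj i x := mulE_smul _ _ _
theorem embed_smul (r : ℝ) (v : Vec (B.size i)) : B.embed i (r • v) = r • B.embed i v :=
  mulE_smul _ _ _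

theorem restrict_proj (φ : Vec n → ℝ) (x : Vec n) : B.restrict φ i x (B.proj i x) = φ x := by
  simp [restrict, embed, mulE_zero]

end Blocks

/-! ### The quadratic form of a scaling matrix -/

section Quadratic

variable {a : ℕ} {D : Matrix (Fin a) (Fin a) ℝ}

theorem inner_mulE_symm (hD : D.transpose = D) (v w : Vec a) :
    inner ℝ (mulE D v) w = inner ℝ v (mulE D w) := by
  rw [inner_mulE_left, hD]

theorem sqNormD_add (hD : D.transpose = D) (v w : Vec a) :
    sqNormD D (v + w) = sqNormD D v + 2 * inner ℝ (mulE D w) v + sqNormD D w := by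
  simp only [sqNormD, mulE_add, inner_add_left, inner_add_right]
  rw [← inner_mulE_symm hD w v, real_inner_comm (mulE D w) v]
  ring

theorem sqNormD_smul (r : ℝ) (v : Vec a) : sqNormD D (r • v) = r ^ 2 * sqNormD D v := by
  simp only [sqNormD, mulE_smul, inner_smul_left, inner_smul_right]
  simp
  ring

/-- Expanding `0 ≤ ‖v - μ⁻¹ D v‖_D²` and using `‖D v‖_D² ≤ μ ‖D v‖²` leaves `‖D v‖² ≤ μ ‖v‖_D² ≤ μ²
‖v‖²`; no spectral decomposition is needed. -/
theorem norm_mulE_le (hD : D.transpose = D) {μ : ℝ} (hμ : 0 < μ)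
    (h0 : ∀ v, 0 ≤ sqNormD D v) (h1 : ∀ v, sqNormD D v ≤ μ * ‖v‖ ^ 2) (v : Vec a) :
    ‖mulE D v‖ ≤ μ * ‖v‖ := by
  set w := mulE D v with hw
  have h := h0 (v + (-1 / μ) • w)
  rw [sqNormD_add hD, mulE_smul, sqNormD_smul, inner_smul_left, inner_mulE_symm hD, ← hw,
    real_inner_self_eq_norm_sq] at h
  have hv := h1 v
  have hw1 := mul_le_mul_of_nonneg_left (h1 w) (sq_nonneg (-1 / μ))
  simp only [conj_trivial] at h
  have e : (-1 / μ) ^ 2 * (μ * ‖w‖ ^ 2) = ‖w‖ ^ 2 / μ := by field_simp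
  have e2 : 2 * (-1 / μ * ‖w‖ ^ 2) = -2 * (‖w‖ ^ 2 / μ) := by ring
  have h2 : ‖w‖ ^ 2 / μ ≤ μ * ‖v‖ ^ 2 := by linarith
  rw [div_le_iff₀ hμ] at h2
  refine (sq_le_sq₀ (norm_nonneg _) (by positivity)).1 ?_
  nlinarith

end Quadratic


/-! ### The model minimized by an inertial proximal-gradient point -/

/-- The function `h` of an iteration in terms of data on the block: `g` is the partial gradient of
the smooth part, `s` the inertial displacement, `q` the current point. -/
noncomputable def blockModel {a : ℕ} (D : Matrix (Fin a) (Fin a) ℝ) (α β : ℝ) (ψ : Vec a → ℝ)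
    (g s q y : Vec a) : ℝ :=
  inner ℝ (g - (β / α) • mulE D s) (y - q) + 1 / (2 * α) * sqNormD D (y - q) + ψ y - ψ q

section Model

variable {a : ℕ} {D : Matrix (Fin a) (Fin a) ℝ} {α β : ℝ} {ψ : Vec a → ℝ} {g s q : Vec a}

theorem blockModel_self : blockModel D α β ψ g s q q = 0 := by
  simp [blockModel, sqNormD]

/-- Completing the square: the proximal objective is `α` times the model plus a constant, so both
have the same minimizers. -/
theorem blockModel_le_of_mem_proxD (hD : D.PosDef) (hα : 0 < α) {yhat : Vec a}
    (hy : yhat ∈ proxD D α ψ (q + β • s - α • mulE D⁻¹ g)) (y : Vec a) :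
    blockModel D α β ψ g s q yhat ≤ blockModel D α β ψ g s q y := by
  have hsymm : D.transpose = D := by
    have := hD.isHermitian.eq
    rwa [Matrix.conjTranspose_eq_transpose_of_trivial] at this
  have hdet : IsUnit D.det := hD.det_pos.ne'.isUnit
  set t : Vec a := -(β • s - α • mulE D⁻¹ g) with ht
  have hDt : mulE D t = -(β • mulE D s - α • g) := by
    rw [ht, ← neg_one_smul ℝ, mulE_smul, mulE_sub, mulE_smul, mulE_smul, ← mulE_mul,
      Matrix.mul_nonsing_inv _ hdet, mulE_one, neg_one_smul]
  have key : ∀ z : Vec a, 1 / 2 * sqNormD D (z - (q + β • s - α • mulE D⁻¹ g)) + α * ψ z =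
      α * blockModel D α β ψ g s q z + (1 / 2 * sqNormD D t + α * ψ q) := by
    intro z
    have e : z - (q + β • s - α • mulE D⁻¹ g) = (z - q) + t := by rw [ht]; abel
    rw [e, sqNormD_add hsymm, hDt, blockModel]
    simp only [inner_sub_left, inner_neg_left, inner_smul_left, conj_trivial]
    field_simp
    ring
  have h := hy y
  rw [key, key] at h
  exact le_of_mul_le_mul_left (by linarith) hα

/-- Comparing the minimizer with the midpoint of `yhat` and `y` is enough. It gives the constant
`1/(4α)`, half of the optimal `1/(2α)`. -/
theorem sqNormD_sub_le_of_min (hD : D.transpose = D) (hα : 0 < α) (hψ : ConvexOn ℝ Set.univ ψ)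
    {yhat : Vec a}
    (hy : ∀ y, blockModel D α β ψ g s q yhat ≤ blockModel D α β ψ g s q y) (y : Vec a) :
    1 / (4 * α) * sqNormD D (y - yhat) ≤
      blockModel D α β ψ g s q y - blockModel D α β ψ g s q yhat := by
  have hm := hy ((1 / 2 : ℝ) • yhat + (1 / 2 : ℝ) • y)
  have hc := hψ.2 (Set.mem_univ yhat) (Set.mem_univ y) (by norm_num : (0 : ℝ) ≤ 1 / 2)
    (by norm_num : (0 : ℝ) ≤ 1 / 2) (by norm_num)
  simp only [smul_eq_mul] at hc
  set u := yhat - q with hu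
  set e := y - yhat with he
  have e1 : (1 / 2 : ℝ) • yhat + (1 / 2 : ℝ) • y - q = u + (1 / 2 : ℝ) • e := by
    rw [hu, he]; module
  have e2 : y - q = u + e := by rw [hu, he]; abel
  simp only [blockModel, e1, e2, ← hu] at hm ⊢
  rw [sqNormD_add hD, sqNormD_smul, mulE_smul] at hm
  rw [sqNormD_add hD]
  simp only [inner_add_right, inner_smul_left, inner_smul_right, conj_trivial] at hm ⊢
  have e3 : 1 / (4 * α) = 1 / 2 * (1 / (2 * α)) := by field_simp; norm_num
  rw [e3]
  nlinarith

/-- The derivative of the model along every line through the minimizer vanishes. -/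
theorem gradient_eq_of_min (hD : D.transpose = D) (hα : 0 < α) {yhat G : Vec a}
    (hy : ∀ y, blockModel D α β ψ g s q yhat ≤ blockModel D α β ψ g s q y)
    (hG : HasGradientAt ψ G yhat) :
    g + G = (β / α) • mulE D s - (1 / α) • mulE D (yhat - q) := by
  refine ext_inner_right ℝ fun v => ?_
  have hline : HasDerivAt (fun t : ℝ => yhat + t • v) v 0 := by
    simpa using ((hasDerivAt_id (0 : ℝ)).smul_const v).const_add yhat
  have hψd : HasDerivAt (fun t : ℝ => ψ (yhat + t • v)) (inner ℝ G v) 0 := by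
    have h0 : HasFDerivAt ψ (InnerProductSpace.toDual ℝ (Vec a) G) (yhat + (0 : ℝ) • v) := by
      simpa using hG.hasFDerivAt
    exact h0.comp_hasDerivAt (0 : ℝ) hline
  have hexp : ∀ t : ℝ, blockModel D α β ψ g s q (yhat + t • v) =
      inner ℝ (g - (β / α) • mulE D s) (yhat - q) + t * inner ℝ (g - (β / α) • mulE D s) v
      + 1 / (2 * α) * (sqNormD D (yhat - q) + t * (2 * inner ℝ (mulE D (yhat - q)) v)
        + t ^ 2 * sqNormD D v) + ψ (yhat + t • v) - ψ q := by
    intro t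
    have e : yhat + t • v - q = (yhat - q) + t • v := by abel
    rw [blockModel, e, sqNormD_add hD, mulE_smul, sqNormD_smul, inner_add_right,
      inner_smul_right, inner_smul_left, inner_mulE_symm hD v, real_inner_comm (mulE D _) v]
    simp only [conj_trivial]
    ring
  have hd : HasDerivAt (fun t : ℝ => blockModel D α β ψ g s q (yhat + t • v))
      (inner ℝ (g - (β / α) • mulE D s) v
        + 1 / (2 * α) * (2 * inner ℝ (mulE D (yhat - q)) v) + inner ℝ G v) 0 := by
    simp only [hexp]
    have h1 := (hasDerivAt_id (0 : ℝ)).mul_const (inner ℝ (g - (β / α) • mulE D s) v)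
    have h2 := (hasDerivAt_id (0 : ℝ)).mul_const (2 * inner ℝ (mulE D (yhat - q)) v)
    have h3 := (hasDerivAt_pow 2 (0 : ℝ)).mul_const (sqNormD D v)
    have h4 := ((h1.const_add (inner ℝ (g - (β / α) • mulE D s) (yhat - q))).add
      (((h2.const_add (sqNormD D (yhat - q))).add h3).const_mul (1 / (2 * α)))).add hψd
    exact (h4.sub_const (ψ q)).congr_deriv (by simp)
  have hmin : IsLocalMin (fun t : ℝ => blockModel D α β ψ g s q (yhat + t • v)) 0 :=
    Filter.Eventually.of_forall fun t => by simpa using hy (yhat + t • v)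
  have h0 := hmin.hasDerivAt_eq_zero hd
  simp only [inner_sub_left, inner_add_left, inner_smul_left, conj_trivial] at h0 ⊢
  have e3 : 1 / (2 * α) * (2 * inner ℝ (mulE D (yhat - q)) v)
      = 1 / α * inner ℝ (mulE D (yhat - q)) v := by field_simp
  rw [e3] at h0
  linarith

end Model

/-! ### First-order estimates -/

theorem gradient_add {n : ℕ} {f φ : Vec n → ℝ} {x : Vec n} (hf : DifferentiableAt ℝ f x)
    (hφ : DifferentiableAt ℝ φ x) :
    gradient (fun v => f v + φ v) x = gradient f x + gradient φ x := by
  have h : HasGradientAt (fun v => f v + φ v) (gradient f x + gradient φ x) x := by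
    rw [hasGradientAt_iff_hasFDerivAt, map_add]
    exact hf.hasGradientAt.hasFDerivAt.add hφ.hasGradientAt.hasFDerivAt
  exact h.gradient

theorem hasGradientAt_restrict {n N : ℕ} (B : Blocks n N) {φ : Vec n → ℝ} (i : Fin N)
    (x : Vec n) (y : Vec (B.size i))
    (hφ : DifferentiableAt ℝ φ (x + B.embed i (y - B.proj i x))) :
    HasGradientAt (B.restrict φ i x)
      (B.proj i (gradient φ (x + B.embed i (y - B.proj i x)))) y := by
  rw [hasGradientAt_iff_hasFDerivAt]
  have hin : HasFDerivAt (fun z => x + B.embed i (z - B.proj i x)) (mulECLM (B.U i)) y :=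
    ((mulECLM (B.U i)).hasFDerivAt.comp y ((hasFDerivAt_id y).sub_const (B.proj i x))).const_add x
  have h := hφ.hasGradientAt.hasFDerivAt.comp y hin
  refine h.congr_fderiv ?_
  ext v
  simp only [ContinuousLinearMap.comp_apply, InnerProductSpace.toDual_apply_apply, mulECLM_apply]
  rw [real_inner_comm, real_inner_comm v]
  exact B.inner_embed i v _

/-- The mean value theorem on the segment suffices; it costs `L` in place of the sharp `L/2`. -/
theorem le_add_inner_gradient_add_sq {n : ℕ} {f : Vec n → ℝ} (hf : Differentiable ℝ f) {L : ℝ}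
    (hL0 : 0 ≤ L) (hL : ∀ u v, ‖gradient f u - gradient f v‖ ≤ L * ‖u - v‖) (x v : Vec n) :
    f (x + v) ≤ f x + inner ℝ (gradient f x) v + L * ‖v‖ ^ 2 := by
  have hline : ∀ t : ℝ, HasDerivAt (fun t : ℝ => x + t • v) v t := fun t => by
    simpa using ((hasDerivAt_id t).smul_const v).const_add x
  have hd : ∀ t : ℝ, HasDerivAt (fun t : ℝ => f (x + t • v))
      (inner ℝ (gradient f (x + t • v)) v) t := fun t => by
    exact (hf (x + t • v)).hasGradientAt.hasFDerivAt.comp_hasDerivAt t (hline t)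
  obtain ⟨t, ht, he⟩ := exists_hasDerivAt_eq_slope (fun t : ℝ => f (x + t • v)) _ zero_lt_one
    (fun t _ => (hd t).continuousAt.continuousWithinAt) (fun t _ => hd t)
  simp only [one_smul, zero_smul, add_zero, sub_zero, div_one] at he
  have h1 : inner ℝ (gradient f (x + t • v) - gradient f x) v ≤ L * ‖v‖ ^ 2 := by
    refine (real_inner_le_norm _ _).trans ?_
    have h2 := hL (x + t • v) x
    have h3 : ‖x + t • v - x‖ ≤ ‖v‖ := by
      rw [add_sub_cancel_left, norm_smul, Real.norm_of_nonneg ht.1.le]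
      exact mul_le_of_le_one_left (norm_nonneg _) ht.2.le
    calc _ ≤ (L * ‖x + t • v - x‖) * ‖v‖ := by gcongr
      _ ≤ (L * ‖v‖) * ‖v‖ := by gcongr
      _ = _ := by ring
  rw [inner_sub_left] at h1
  linarith


/-! ### Estimates for one iteration -/

section Model

variable {a : ℕ} {D : Matrix (Fin a) (Fin a) ℝ} {α β : ℝ} {ψ : Vec a → ℝ} {g s q : Vec a}

/-- Quadratic growth is applied at `q`, where the model vanishes, and at `y`. The approximation
hypothesis gives `-h(yhat) ≤ (1 + τ/2) (-h(y))`, relaxed to the factor `1 + τ`. -/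
theorem approx_min_bounds (hD : D.transpose = D) (hα : 0 < α) (hψ : ConvexOn ℝ Set.univ ψ)
    {αmax μ τ : ℝ} (hαmax : α ≤ αmax) (hμ : 0 < μ) (hτ : 0 ≤ τ)
    (hDl : ∀ v, 1 / μ * ‖v‖ ^ 2 ≤ sqNormD D v) {yhat y : Vec a}
    (hy : ∀ z, blockModel D α β ψ g s q yhat ≤ blockModel D α β ψ g s q z)
    (happ : blockModel D α β ψ g s q y ≤ 2 / (2 + τ) * blockModel D α β ψ g s q yhat) :
    0 ≤ -blockModel D α β ψ g s q y ∧
    ‖yhat - q‖ ^ 2 ≤ 4 * αmax * μ * (1 + τ) * -blockModel D α β ψ g s q y ∧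
    ‖y - yhat‖ ^ 2 ≤ 4 * αmax * μ * (1 + τ) * -blockModel D α β ψ g s q y := by
  have hαm : 0 < αmax := hα.trans_le hαmax
  have h1 : ∀ z, ‖z - yhat‖ ^ 2 ≤ 4 * αmax * μ *
      (blockModel D α β ψ g s q z - blockModel D α β ψ g s q yhat) := by
    intro z
    have h2 := sqNormD_sub_le_of_min hD hα hψ hy z
    have h3 := hDl (z - yhat)
    have h4 : 1 / (4 * αmax) * (1 / μ * ‖z - yhat‖ ^ 2) ≤ 1 / (4 * α) * sqNormD D (z - yhat) := by
      gcongr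
    have h5 := h4.trans h2
    have h6 : 1 / (4 * αmax) * (1 / μ * ‖z - yhat‖ ^ 2) = ‖z - yhat‖ ^ 2 / (4 * αmax * μ) := by
      field_simp
    rw [h6, div_le_iff₀ (by positivity)] at h5
    linarith
  set m0 := blockModel D α β ψ g s q yhat
  set m1 := blockModel D α β ψ g s q y
  have h0 : m0 ≤ 0 := (hy q).trans_eq blockModel_self
  have h7 : (2 + τ) * m1 ≤ 2 * m0 := by
    rw [div_mul_eq_mul_div, le_div_iff₀ (by positivity)] at happ
    linarith
  have h8 : m1 ≤ 0 := by
    refine happ.trans (mul_nonpos_of_nonneg_of_nonpos (by positivity) h0)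
  have h9 : 0 ≤ τ * -m1 := mul_nonneg hτ (neg_nonneg.2 h8)
  have hc : 0 ≤ 4 * αmax * μ := by positivity
  refine ⟨neg_nonneg.2 h8, ?_, ?_⟩
  · rw [norm_sub_rev]
    refine (h1 q).trans ?_
    rw [blockModel_self, mul_assoc (4 * αmax * μ)]
    exact mul_le_mul_of_nonneg_left (by linarith) hc
  · refine (h1 y).trans ?_
    rw [mul_assoc (4 * αmax * μ)]
    exact mul_le_mul_of_nonneg_left (by linarith) hc

theorem norm_gradient_le_of_min (hD : D.transpose = D) (hα : 0 < α) {αmin βmax μ : ℝ}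
    (hαmin0 : 0 < αmin) (hαmin : αmin ≤ α) (hβ0 : 0 ≤ β) (hβ : β ≤ βmax) (hμ : 0 < μ)
    (hD0 : ∀ v, 0 ≤ sqNormD D v) (hDu : ∀ v, sqNormD D v ≤ μ * ‖v‖ ^ 2) {yhat G : Vec a}
    (hy : ∀ z, blockModel D α β ψ g s q yhat ≤ blockModel D α β ψ g s q z)
    (hG : HasGradientAt ψ G yhat) :
    ‖g + G‖ ≤ βmax / αmin * (μ * ‖s‖) + 1 / αmin * (μ * ‖yhat - q‖) := by
  rw [gradient_eq_of_min hD hα hy hG]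
  refine (norm_sub_le _ _).trans ?_
  rw [norm_smul, norm_smul, Real.norm_of_nonneg (by positivity), Real.norm_of_nonneg (by positivity)]
  have h1 := norm_mulE_le hD hμ hD0 hDu s
  have h2 := norm_mulE_le hD hμ hD0 hDu (yhat - q)
  have : 0 ≤ βmax := hβ0.trans hβ
  gcongr

end Model

/-- Convexity of `φ` on the block produces the term linear in `t`, and the gradient bound for `f` a
term of order `t²`. The inertial cross term is split by Young's inequality so that its first part is
exactly the `γ/2 ‖B.proj i (x - w)‖²` allowed by the Armijo test and the rest is again of order
`t²`. -/
theorem le_of_small_step {n N : ℕ} (B : Blocks n N) {f φ : Vec n → ℝ} (hf : Differentiable ℝ f)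
    {L : ℝ} (hL0 : 0 ≤ L) (hL : ∀ u v, ‖gradient f u - gradient f v‖ ≤ L * ‖u - v‖) (i : Fin N)
    {x w : Vec n} (hφ : ConvexOn ℝ Set.univ (B.restrict φ i x))
    {D : Matrix (Fin (B.size i)) (Fin (B.size i)) ℝ} (hD : D.transpose = D)
    {α αmin β βmax μ γ : ℝ} (hαmin0 : 0 < αmin) (hαmin : αmin ≤ α) (hβ0 : 0 ≤ β) (hβ : β ≤ βmax)
    (hμ : 0 < μ) (hγ : 0 < γ)
    (hD0 : ∀ v, 0 ≤ sqNormD D v) (hDu : ∀ v, sqNormD D v ≤ μ * ‖v‖ ^ 2)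
    (y : Vec (B.size i)) {t : ℝ} (ht0 : 0 ≤ t) (ht1 : t ≤ 1) :
    (f (x + t • B.embed i (y - B.proj i x)) + φ (x + t • B.embed i (y - B.proj i x)))
      + γ / 2 * ‖t • (y - B.proj i x)‖ ^ 2 ≤ f x + φ x + γ / 2 * ‖B.proj i (x - w)‖ ^ 2
      + t * hFun B f φ i α β D x w y
      + t ^ 2 * ((L + (βmax / αmin * μ) ^ 2 / (2 * γ) + γ / 2) * ‖y - B.proj i x‖ ^ 2) := by
  set d := y - B.proj i x with hd
  set s := B.proj i (x - w) with hs
  have hα : 0 < α := hαmin0.trans_le hαmin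
  have hβm : 0 ≤ βmax := hβ0.trans hβ
  have h1 := le_add_inner_gradient_add_sq hf hL0 hL x (t • B.embed i d)
  rw [inner_smul_right, real_inner_comm, B.inner_embed, norm_smul, B.norm_embed,
    Real.norm_of_nonneg ht0, mul_pow] at h1
  have h2 : φ (x + t • B.embed i d) ≤ (1 - t) * φ x + t * B.restrict φ i x y := by
    have h := hφ.2 (Set.mem_univ (B.proj i x)) (Set.mem_univ y) (sub_nonneg.2 ht1) ht0 (by ring)
    simp only [smul_eq_mul, B.restrict_proj] at h
    have e : (1 - t) • B.proj i x + t • y = B.proj i x + t • d := by rw [hd]; module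
    rw [e] at h
    refine le_of_eq_of_le ?_ h
    simp only [Blocks.restrict, add_sub_cancel_left, B.embed_smul]
  have h3 : inner ℝ ((β / α) • mulE D s) d ≤ βmax / αmin * μ * ‖s‖ * ‖d‖ := by
    refine (real_inner_le_norm _ _).trans ?_
    rw [norm_smul, Real.norm_of_nonneg (by positivity), mul_assoc (βmax / αmin)]
    have h := norm_mulE_le hD hμ hD0 hDu s
    gcongr
  have h4 : t * (βmax / αmin * μ * ‖s‖ * ‖d‖) ≤ γ / 2 * ‖s‖ ^ 2
      + t ^ 2 * ((βmax / αmin * μ) ^ 2 / (2 * γ) * ‖d‖ ^ 2) := by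
    set K := βmax / αmin * μ
    have h := mul_nonneg (by positivity : (0:ℝ) ≤ γ / 2) (sq_nonneg (‖s‖ - t * K * ‖d‖ / γ))
    have e : γ / 2 * (‖s‖ - t * K * ‖d‖ / γ) ^ 2 = γ / 2 * ‖s‖ ^ 2 - t * (K * ‖s‖ * ‖d‖)
        + t ^ 2 * (K ^ 2 / (2 * γ) * ‖d‖ ^ 2) := by
      field_simp
      ring
    linarith
  have h5 : 0 ≤ 1 / (2 * α) * sqNormD D d := mul_nonneg (by positivity) (hD0 d)
  have h6 : hFun B f φ i α β D x w y = inner ℝ (B.proj i (gradient f x)) d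
      - inner ℝ ((β / α) • mulE D s) d + 1 / (2 * α) * sqNormD D d + B.restrict φ i x y - φ x := by
    rw [hFun, B.restrict_proj, inner_sub_left]
  have h7 : inner ℝ d (B.proj i (gradient f x)) = inner ℝ (B.proj i (gradient f x)) d :=
    real_inner_comm _ _
  rw [h7] at h1
  rw [h6, norm_smul, Real.norm_of_nonneg ht0, mul_pow]
  have h8 := mul_le_mul_of_nonneg_left h3 ht0
  have h9 := mul_nonneg ht0 h5
  nlinarith

/-- If backtracking took place, the previous trial step was rejected and hence exceeds `r`. -/
theorem pow_ge_of_isLeast {A : ℝ → Prop} {δ r : ℝ} (hδ0 : 0 < δ) (hδ1 : δ < 1)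
    (hA : ∀ t, 0 < t → t ≤ 1 → t ≤ r → A t) {m : ℕ} (hm : IsLeast {j : ℕ | A (δ ^ j)} m) :
    min 1 (δ * r) ≤ δ ^ m := by
  rcases m with _ | j
  · simp
  · refine (min_le_right _ _).trans ?_
    have h : ¬ A (δ ^ j) := fun h => (Nat.lt_succ_self j).not_ge (hm.2 h)
    have h2 : r < δ ^ j := by
      by_contra! h3
      exact h (hA _ (by positivity) (pow_le_one₀ hδ0.le hδ1.le) h3)
    rw [pow_succ']
    gcongr

theorem nextIterate_spec {n N : ℕ} (B : Blocks n N) (F : Vec n → ℝ) (γ : ℝ) (i : Fin N)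
    (x : Vec n) (d : Vec (B.size i)) {lam : ℝ} (h0 : 0 ≤ lam) (h1 : lam ≤ 1) :
    ∃ t : ℝ, 0 ≤ t ∧ t ≤ 1 ∧ nextIterate B F γ i x d lam = x + B.embed i (t • d) ∧
      F (nextIterate B F γ i x d lam) + γ / 2 * ‖nextIterate B F γ i x d lam - x‖ ^ 2 ≤
        F (x + lam • B.embed i d) + γ / 2 * ‖lam • d‖ ^ 2 := by
  unfold nextIterate
  split_ifs with h
  · refine ⟨1, zero_le_one, le_rfl, by simp, ?_⟩
    rw [add_sub_cancel_left, B.norm_embed, norm_smul, Real.norm_of_nonneg h0, mul_pow]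
    linarith
  · refine ⟨lam, h0, h1, by rw [B.embed_smul], ?_⟩
    rw [add_sub_cancel_left, ← B.embed_smul, B.norm_embed]


/-! ### Uniform estimates along a bounded run -/

theorem exists_lipschitz_gradient_of_isBounded {n : ℕ} {f φ : Vec n → ℝ}
    (hf : Differentiable ℝ f) (hφ : Differentiable ℝ φ)
    (hf_lip : ∃ Lf : ℝ, 0 < Lf ∧ ∀ u v, ‖gradient f u - gradient f v‖ ≤ Lf * ‖u - v‖)
    (hφ_lip : ∀ K : Set (Vec n), IsCompact K → ∃ Lφ : ℝ, 0 < Lφ ∧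
      ∀ u ∈ K, ∀ v ∈ K, ‖gradient φ u - gradient φ v‖ ≤ Lφ * ‖u - v‖)
    {s : Set (Vec n)} (hs : Bornology.IsBounded s) :
    ∃ L : ℝ, 0 < L ∧ ∀ u ∈ s, ∀ v ∈ s,
      ‖gradient (fun z => f z + φ z) u - gradient (fun z => f z + φ z) v‖ ≤ L * ‖u - v‖ := by
  obtain ⟨Lf, hLf0, hLf⟩ := hf_lip
  obtain ⟨Lφ, hLφ0, hLφ⟩ := hφ_lip _ hs.isCompact_closure
  refine ⟨Lf + Lφ, by positivity, fun u hu v hv => ?_⟩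
  rw [gradient_add (hf u) (hφ u), gradient_add (hf v) (hφ v), add_sub_add_comm, add_mul]
  exact (norm_add_le _ _).trans
    (add_le_add (hLf u v) (hLφ u (subset_closure hu) v (subset_closure hv)))

/-- The quantities `H k = -h_k(ỹ_k)` of a bounded run bound the steps and the partial gradients, and
are bounded by the decrease of the objective up to inertial terms. -/
theorem exists_step_estimates {n N : ℕ} [NeZero N] (B : Blocks n N) (p : Params)
    (f φ : Vec n → ℝ) (hf : Differentiable ℝ f)
    (hφ_conv : ∀ (i : Fin N) (v : Vec n), ConvexOn ℝ Set.univ (B.restrict φ i v))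
    (hF_low : ∃ Flow : ℝ, ∀ v, Flow ≤ f v + φ v)
    (hf_lip : ∃ Lf : ℝ, 0 < Lf ∧ ∀ u v, ‖gradient f u - gradient f v‖ ≤ Lf * ‖u - v‖)
    (hφ : Differentiable ℝ φ)
    (hφ_lip : ∀ K : Set (Vec n), IsCompact K → ∃ Lφ : ℝ, 0 < Lφ ∧
      ∀ u ∈ K, ∀ v ∈ K, ‖gradient φ u - gradient φ v‖ ≤ Lφ * ‖u - v‖)
    (x : ℕ → Vec n) (α β : ℕ → ℝ)
    (D : (k : ℕ) → Matrix (Fin (B.size (blockIdx N k))) (Fin (B.size (blockIdx N k))) ℝ)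
    (ytil : (k : ℕ) → Vec (B.size (blockIdx N k))) (m : ℕ → ℕ)
    (hrun : IsRun B p f φ x α β D ytil m) (hbdd : Bornology.IsBounded (Set.range x)) :
    ∃ a b : ℝ, 0 < a ∧ 0 < b ∧ ∃ H : ℕ → ℝ, ∀ k, 0 ≤ H k ∧ ‖x (k + 1) - x k‖ ≤ b * √(H k) ∧
      f (x (k + 1)) + φ (x (k + 1)) + p.γ / 2 * ‖x (k + 1) - x k‖ ^ 2 + a * H k ≤
        f (x k) + φ (x k) + p.γ / 2 * ‖B.proj (blockIdx N k) (x k - lagged N x k)‖ ^ 2 ∧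
      ‖B.proj (blockIdx N k) (gradient (fun v => f v + φ v) (x k))‖ ≤
        b * (√(H k) + ‖B.proj (blockIdx N k) (x k - lagged N x k)‖) ∧
      ∃ v, x (k + 1) = x k + B.embed (blockIdx N k) v := by
  obtain ⟨Flow, hFlow⟩ := hF_low
  obtain ⟨Lf, hLf0, hLf⟩ := hf_lip
  have hαmin := p.αmin_pos
  have hαmax : 0 < p.αmax := p.αmin_pos.trans_le p.αmin_le
  have hβ := p.βmax_pos
  have hμ := p.μ_pos
  have hτ := p.τ_nonneg
  have hγ := p.γ_pos
  have hδ := p.δ_pos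
  have hσ := p.σ_pos
  have hσ1 : 0 < 1 - p.σ := sub_pos.2 p.σ_lt_one
  set H : ℕ → ℝ := fun k => -hFun B f φ (blockIdx N k) (α k) (β k) (D k) (x k)
    (lagged N x k) (ytil k) with hH
  have hsymm : ∀ k, (D k).transpose = D k := fun k => by
    have := (hrun.D_posDef k).isHermitian.eq
    rwa [Matrix.conjTranspose_eq_transpose_of_trivial] at this
  have hα0 : ∀ k, 0 < α k := fun k => hαmin.trans_le (hrun.α_mem k).1
  have hD0 : ∀ k v, 0 ≤ sqNormD (D k) v := fun k v =>
    le_trans (by positivity) (hrun.D_lower k v)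
  choose yhat hyhat happ using hrun.approx
  have hmin : ∀ k z, blockModel (D k) (α k) (β k) (B.restrict φ (blockIdx N k) (x k))
      (B.proj (blockIdx N k) (gradient f (x k))) (B.proj (blockIdx N k) (x k - lagged N x k))
      (B.proj (blockIdx N k) (x k)) (yhat k) ≤
      blockModel (D k) (α k) (β k) (B.restrict φ (blockIdx N k) (x k))
      (B.proj (blockIdx N k) (gradient f (x k))) (B.proj (blockIdx N k) (x k - lagged N x k))
      (B.proj (blockIdx N k) (x k)) z := fun k => by
    have h := hyhat k
    rw [B.proj_add, B.proj_smul] at h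
    exact blockModel_le_of_mem_proxD (hrun.D_posDef k) (hα0 k) h
  set C1 : ℝ := 4 * p.αmax * p.μ * (1 + p.τ) with hC1
  have hC1pos : 0 < C1 := by positivity
  have hbd : ∀ k, 0 ≤ H k ∧ ‖yhat k - B.proj (blockIdx N k) (x k)‖ ^ 2 ≤ C1 * H k ∧
      ‖ytil k - yhat k‖ ^ 2 ≤ C1 * H k := fun k =>
    approx_min_bounds (hsymm k) (hα0 k) (hφ_conv _ _) (hrun.α_mem k).2 hμ hτ (hrun.D_lower k)
      (hmin k) (happ k)
  have hH0 : ∀ k, 0 ≤ H k := fun k => (hbd k).1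
  have hyq : ∀ k, ‖yhat k - B.proj (blockIdx N k) (x k)‖ ≤ √C1 * √(H k) := fun k => by
    rw [← Real.sqrt_mul hC1pos.le]
    exact Real.le_sqrt_of_sq_le (hbd k).2.1
  have hyy : ∀ k, ‖ytil k - yhat k‖ ≤ √C1 * √(H k) := fun k => by
    rw [← Real.sqrt_mul hC1pos.le]
    exact Real.le_sqrt_of_sq_le (hbd k).2.2
  have hd : ∀ k, ‖ytil k - B.proj (blockIdx N k) (x k)‖ ≤ 2 * √C1 * √(H k) := fun k => by
    have h := norm_add_le (ytil k - yhat k) (yhat k - B.proj (blockIdx N k) (x k))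
    rw [sub_add_sub_cancel] at h
    linarith [hyq k, hyy k]
  have hd2 : ∀ k, ‖ytil k - B.proj (blockIdx N k) (x k)‖ ^ 2 ≤ 4 * C1 * H k := fun k => by
    refine (pow_le_pow_left₀ (norm_nonneg _) (hd k) 2).trans_eq ?_
    rw [mul_pow, mul_pow, Real.sq_sqrt hC1pos.le, Real.sq_sqrt (hH0 k)]
    norm_num
  set C0 : ℝ := Lf + (p.βmax / p.αmin * p.μ) ^ 2 / (2 * p.γ) + p.γ / 2 with hC0
  have hC0pos : 0 < C0 := by positivity
  -- For `t ≤ r` the quadratic remainder `t² C0 (4 C1 H)` is at most the slack `t (1 - σ) H` in the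
  -- Armijo test.
  set r : ℝ := (1 - p.σ) / (C0 * (4 * C1)) with hr
  have hrpos : 0 < r := by positivity
  have hlam : ∀ k, min 1 (p.δ * r) ≤ p.δ ^ m k := fun k => by
    refine pow_ge_of_isLeast hδ p.δ_lt_one (fun t ht0 ht1 htr => ?_) (hrun.lineSearch k)
    have h := le_of_small_step B hf hLf0.le hLf (blockIdx N k) (w := lagged N x k)
      (hφ_conv _ (x k)) (hsymm k)
      hαmin (hrun.α_mem k).1 (hrun.β_mem k).1 (hrun.β_mem k).2 hμ hγ (hD0 k) (hrun.D_upper k)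
      (ytil k) ht0.le ht1
    refine h.trans ?_
    have h1 : t ^ 2 * (C0 * ‖ytil k - B.proj (blockIdx N k) (x k)‖ ^ 2) ≤
        t * ((1 - p.σ) * H k) := by
      calc _ ≤ t ^ 2 * (C0 * (4 * C1 * H k)) := by
            have := hd2 k
            gcongr
        _ = t * (t * (C0 * (4 * C1))) * H k := by ring
        _ ≤ t * (r * (C0 * (4 * C1))) * H k := by
            have := hH0 k
            gcongr
        _ = t * ((1 - p.σ) * H k) := by
            rw [hr, div_mul_cancel₀ _ (by positivity)]
            ring
    simp only [hH] at h1
    rw [← hC0]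
    beta_reduce
    linarith
  set a : ℝ := p.σ * min 1 (p.δ * r) with ha
  have hapos : 0 < a := mul_pos hσ (lt_min one_pos (by positivity))
  have hstep : ∀ k, ∃ t : ℝ, 0 ≤ t ∧ t ≤ 1 ∧ x (k + 1) = x k +
      B.embed (blockIdx N k) (t • (ytil k - B.proj (blockIdx N k) (x k))) ∧
      f (x (k + 1)) + φ (x (k + 1)) + p.γ / 2 * ‖x (k + 1) - x k‖ ^ 2 + a * H k ≤
        f (x k) + φ (x k) + p.γ / 2 * ‖B.proj (blockIdx N k) (x k - lagged N x k)‖ ^ 2 := by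
    intro k
    obtain ⟨t, ht0, ht1, he, hle⟩ := nextIterate_spec B (fun z => f z + φ z) p.γ (blockIdx N k)
      (x k) (ytil k - B.proj (blockIdx N k) (x k)) (pow_nonneg hδ.le (m k))
      (pow_le_one₀ hδ.le p.δ_lt_one.le)
    rw [← hrun.step k] at he hle
    refine ⟨t, ht0, ht1, he, ?_⟩
    have h1 := hle.trans (hrun.lineSearch k).1
    have h2 : a * H k ≤ p.σ * p.δ ^ m k * H k := by
      have := hlam k
      have := hH0 k
      rw [ha]
      gcongr
    simp only [hH] at h1 h2 ⊢
    linarith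
  -- Boundedness of the run bounds `H`, which keeps the exact proximal points in a fixed ball where
  -- `∇φ` is Lipschitz.
  obtain ⟨R, hR⟩ := hbdd.exists_norm_le
  have hxR : ∀ k, ‖x k‖ ≤ R := fun k => hR _ ⟨k, rfl⟩
  have hR0 : 0 ≤ R := (norm_nonneg _).trans (hxR 0)
  obtain ⟨FM, hFM⟩ : ∃ FM : ℝ, ∀ k, f (x k) + φ (x k) ≤ FM := by
    obtain ⟨FM, hFM⟩ := (isCompact_closedBall (0 : Vec n) R).bddAbove_image
      (hf.continuous.add hφ.continuous).continuousOn
    exact ⟨FM, fun k => hFM ⟨x k, by simpa using hxR k, rfl⟩⟩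
  set HM : ℝ := (FM + p.γ / 2 * (2 * R) ^ 2 - Flow) / a with hHM
  have hHbd : ∀ k, H k ≤ HM := fun k => by
    obtain ⟨t, -, -, -, h⟩ := hstep k
    rw [hHM, le_div_iff₀ hapos]
    have h1 : ‖B.proj (blockIdx N k) (x k - lagged N x k)‖ ≤ 2 * R := by
      refine (B.norm_proj_le _ _).trans ((norm_sub_le _ _).trans ?_)
      have : ‖lagged N x k‖ ≤ R := by
        unfold lagged
        split_ifs <;> exact hxR _
      linarith [hxR k]
    have h2 : p.γ / 2 * ‖B.proj (blockIdx N k) (x k - lagged N x k)‖ ^ 2 ≤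
        p.γ / 2 * (2 * R) ^ 2 := by gcongr
    have h3 : 0 ≤ p.γ / 2 * ‖x (k + 1) - x k‖ ^ 2 := by positivity
    linarith [hFlow (x (k + 1)), hFM k]
  obtain ⟨Lφ, hLφ0, hLφ⟩ := hφ_lip _ (isCompact_closedBall (0 : Vec n) (R + √C1 * √HM))
  set b : ℝ := 2 * √C1 + p.βmax / p.αmin * p.μ + (1 / p.αmin * p.μ + Lφ) * √C1 with hb
  have hbpos : 0 < b := by positivity
  have hb1 : 2 * √C1 ≤ b := by
    have : 0 ≤ p.βmax / p.αmin * p.μ + (1 / p.αmin * p.μ + Lφ) * √C1 := by positivity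
    linarith
  have hb2 : p.βmax / p.αmin * p.μ ≤ b := by
    have : 0 ≤ 2 * √C1 + (1 / p.αmin * p.μ + Lφ) * √C1 := by positivity
    linarith
  have hb3 : (1 / p.αmin * p.μ + Lφ) * √C1 ≤ b := by
    have : 0 ≤ 2 * √C1 + p.βmax / p.αmin * p.μ := by positivity
    linarith
  refine ⟨a, b, hapos, hbpos, H, fun k => ?_⟩
  obtain ⟨t, ht0, ht1, he, hle⟩ := hstep k
  refine ⟨hH0 k, ?_, hle, ?_, _, he⟩
  · rw [he, add_sub_cancel_left, B.norm_embed, norm_smul, Real.norm_of_nonneg ht0]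
    calc t * ‖ytil k - B.proj (blockIdx N k) (x k)‖
        ≤ 1 * (2 * √C1 * √(H k)) := by
          have := hd k
          gcongr
      _ ≤ b * √(H k) := by
          rw [one_mul]
          gcongr
  · set q := B.proj (blockIdx N k) (x k) with hq
    set s := B.proj (blockIdx N k) (x k - lagged N x k) with hs
    -- Optimality of `yhat k` involves `∇φ` at the proximal point `w`; the Lipschitz bound carries
    -- it back to `x k`.
    set w : Vec n := x k + B.embed (blockIdx N k) (yhat k - q) with hw
    have h1 := norm_gradient_le_of_min (hsymm k) (hα0 k) hαmin (hrun.α_mem k).1 (hrun.β_mem k).1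
      (hrun.β_mem k).2 hμ (hD0 k) (hrun.D_upper k) (hmin k)
      (hasGradientAt_restrict B (blockIdx N k) (x k) (yhat k) (hφ _))
    have hwx : ‖x k - w‖ = ‖yhat k - q‖ := by
      rw [hw, sub_add_cancel_left, norm_neg, B.norm_embed]
    have hyM : √C1 * √(H k) ≤ √C1 * √HM := by
      have := hHbd k
      gcongr
    have h2 : ‖gradient φ (x k) - gradient φ w‖ ≤ Lφ * ‖yhat k - q‖ := by
      rw [← hwx]
      refine hLφ _ ?_ _ ?_
      · rw [mem_closedBall_zero_iff]
        exact (hxR k).trans (le_add_of_nonneg_right (by positivity))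
      · rw [mem_closedBall_zero_iff]
        refine (norm_add_le _ _).trans (add_le_add (hxR k) ?_)
        rw [B.norm_embed]
        exact (hyq k).trans hyM
    rw [gradient_add (hf _) (hφ _)]
    have e : B.proj (blockIdx N k) (gradient f (x k) + gradient φ (x k)) =
        (B.proj (blockIdx N k) (gradient f (x k)) + B.proj (blockIdx N k) (gradient φ w)) +
        B.proj (blockIdx N k) (gradient φ (x k) - gradient φ w) := by
      rw [B.proj_add, B.proj_sub]
      abel
    rw [e]
    calc _ ≤ _ := norm_add_le _ _
      _ ≤ (p.βmax / p.αmin * (p.μ * ‖s‖) + 1 / p.αmin * (p.μ * ‖yhat k - q‖)) +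
          Lφ * ‖yhat k - q‖ := add_le_add h1 ((B.norm_proj_le _ _).trans h2)
      _ = p.βmax / p.αmin * p.μ * ‖s‖ + (1 / p.αmin * p.μ + Lφ) * ‖yhat k - q‖ := by ring
      _ ≤ p.βmax / p.αmin * p.μ * ‖s‖ + (1 / p.αmin * p.μ + Lφ) * (√C1 * √(H k)) := by
          have := hyq k
          gcongr
      _ ≤ b * ‖s‖ + b * √(H k) := by
          rw [← mul_assoc]
          gcongr
      _ = _ := by ring


/-! ### Sequences whose steps are controlled near a cluster point -/

/-- Inside the ball `dist (u k) z + V k` cannot increase. Once it is below `min ε ρ`, which happens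
at some late index because `z` is a cluster point and `V` tends to `0`, the sequence never leaves.
-/
theorem tendsto_of_lyapunov {E : Type*} [PseudoMetricSpace E] {u : ℕ → E} {z : E} {V : ℕ → ℝ}
    (hV0 : ∀ᶠ k in atTop, 0 ≤ V k) (hV : Tendsto V atTop (𝓝 0)) {ρ : ℝ} (hρ : 0 < ρ)
    (h : ∀ᶠ k in atTop, dist (u k) z < ρ → dist (u (k + 1)) (u k) ≤ V k - V (k + 1))
    (hcl : ∀ ε > 0, ∃ᶠ k in atTop, dist (u k) z < ε) : Tendsto u atTop (𝓝 z) := by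
  rw [Metric.tendsto_atTop]
  intro ε hε
  have hmin : 0 < min ε ρ / 2 := by positivity
  obtain ⟨K1, hK1⟩ := eventually_atTop.1 (hV0.and h)
  have hev := (eventually_ge_atTop K1).and (hV.eventually_lt_const hmin)
  obtain ⟨K, hdK, hK, hVK⟩ := ((hcl _ hmin).and_eventually hev).exists
  have key : ∀ j, dist (u (K + j)) z + V (K + j) < min ε ρ := by
    intro j
    induction j with
    | zero =>
      rw [add_zero]
      linarith
    | succ j ih =>
      obtain ⟨h1, h2⟩ := hK1 (K + j) (by omega)
      have h3 := h2 (by linarith [min_le_right ε ρ])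
      have h4 := dist_triangle (u (K + j + 1)) (u (K + j)) z
      rw [← add_assoc]
      linarith
  refine ⟨K, fun k hk => ?_⟩
  obtain ⟨j, rfl⟩ := Nat.exists_eq_add_of_le hk
  have h1 := (hK1 (K + j) (by omega)).1
  linarith [key j, min_le_left ε ρ]

theorem IsDesingularizing.deriv_mul_sub_le {ξ : ℝ → ℝ} {ν s t : ℝ} (h : IsDesingularizing ξ ν)
    (hs : 0 ≤ s) (hst : s ≤ t) (ht0 : 0 < t) (ht : t < ν) :
    deriv ξ t * (t - s) ≤ ξ t - ξ s := by
  rcases hst.eq_or_lt with rfl | hlt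
  · simp
  have hd : DifferentiableAt ℝ ξ t :=
    (h.contDiffOn.differentiableOn one_ne_zero).differentiableAt (Ioo_mem_nhds ht0 ht)
  have h1 := h.concaveOn.deriv_le_slope ⟨hs, hlt.trans ht⟩ ⟨ht0.le, ht⟩ hlt hd
  rwa [slope_def_field, le_div_iff₀ (sub_pos.2 hlt)] at h1

/-- With `S` the sum of the two earlier square roots, the KL bound and concavity give `e (k+2) - e
(k+3) ≤ S * (M * Δξ)`, where `Δξ = ξ (e (k+2)) - ξ (e (k+3))`. The inequality `√(S y) ≤ S/4 + y`
then yields a recursion that telescopes. -/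
theorem exists_lyapunov_of_kl {e : ℕ → ℝ} (he : Antitone e) (he0 : ∀ k, 0 ≤ e k)
    (het : Tendsto e atTop (𝓝 0)) {ξ : ℝ → ℝ} {ν M : ℝ} (hν : 0 < ν) (hM : 0 < M)
    (hξ : IsDesingularizing ξ ν) {P : ℕ → Prop}
    (hKL : ∀ᶠ k in atTop, P k → 0 < e (k + 2) →
      1 ≤ deriv ξ (e (k + 2)) * (M * (√(e (k + 1) - e (k + 2)) + √(e k - e (k + 1))))) :
    ∃ V : ℕ → ℝ, (∀ᶠ k in atTop, 0 ≤ V k) ∧ Tendsto V atTop (𝓝 0) ∧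
      ∀ᶠ k in atTop, P k → √(e (k + 2) - e (k + 3)) ≤ V k - V (k + 1) := by
  have hsh : ∀ j, Tendsto (fun k => e (k + j)) atTop (𝓝 0) := fun j =>
    (tendsto_add_atTop_iff_nat j).2 het
  have hR : ∀ j, Tendsto (fun k => √(e (k + j) - e (k + (j + 1)))) atTop (𝓝 0) := fun j => by
    simpa using ((hsh j).sub (hsh (j + 1))).sqrt
  have hlt : ∀ᶠ k in atTop, e k < ν := het.eventually_lt_const hν
  have hlt2 : ∀ᶠ k in atTop, e (k + 2) < ν := (hsh 2).eventually_lt_const hν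
  -- The weights `1/2` and `1/4` turn the two previous roots, each with coefficient `1/4`, into a
  -- difference; half of the newest root remains, and the factor `2` restores it.
  refine ⟨fun k => 2 * (M * ξ (e (k + 2)) + √(e (k + 1) - e (k + 2)) / 2
    + √(e k - e (k + 1)) / 4), ?_, ?_, ?_⟩
  · filter_upwards [hlt2] with k hk
    have := hξ.nonneg _ ⟨he0 (k + 2), hk⟩
    positivity
  · have h1 : Tendsto (fun k => ξ (e (k + 2))) atTop (𝓝 0) := by
      have hc : ContinuousWithinAt ξ (Set.Ico 0 ν) 0 := hξ.continuousOn 0 ⟨le_rfl, hν⟩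
      rw [ContinuousWithinAt, hξ.map_zero] at hc
      refine hc.comp (tendsto_nhdsWithin_iff.2 ⟨hsh 2, ?_⟩)
      filter_upwards [hlt2] with k hk using ⟨he0 _, hk⟩
    have h2 := ((h1.const_mul M).add ((hR 1).div_const 2)).add ((hR 0).div_const 4)
    simpa using h2.const_mul 2
  · filter_upwards [hKL, hlt2] with k hk hkν hP
    have e23 : e (k + 3) ≤ e (k + 2) := he (by omega)
    have hΔ : √(e (k + 2) - e (k + 3)) ≤ (√(e (k + 1) - e (k + 2)) + √(e k - e (k + 1))) / 4
        + M * (ξ (e (k + 2)) - ξ (e (k + 3))) := by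
      rcases (he0 (k + 2)).eq_or_lt with h0 | h0
      · have h3 : e (k + 3) = 0 := le_antisymm (e23.trans h0.symm.le) (he0 _)
        rw [← h0, h3]
        simp only [sub_self, Real.sqrt_zero, mul_zero, add_zero]
        positivity
      · have h1 := hk hP h0
        set S := √(e (k + 1) - e (k + 2)) + √(e k - e (k + 1)) with hS
        have hS0 : 0 ≤ S := by positivity
        have h2 := hξ.deriv_mul_sub_le (he0 (k + 3)) e23 h0 hkν
        have hdpos := hξ.deriv_pos _ ⟨h0, hkν⟩
        have hsub : 0 ≤ e (k + 2) - e (k + 3) := sub_nonneg.2 e23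
        have hξ0 : 0 ≤ ξ (e (k + 2)) - ξ (e (k + 3)) :=
          (mul_nonneg hdpos.le hsub).trans h2
        rw [Real.sqrt_le_left (by positivity)]
        calc e (k + 2) - e (k + 3)
            ≤ deriv ξ (e (k + 2)) * (M * S) * (e (k + 2) - e (k + 3)) :=
              le_mul_of_one_le_left hsub h1
          _ = M * S * (deriv ξ (e (k + 2)) * (e (k + 2) - e (k + 3))) := by ring
          _ ≤ M * S * (ξ (e (k + 2)) - ξ (e (k + 3))) := by gcongr
          _ ≤ _ := by
              nlinarith [sq_nonneg (S / 4 - M * (ξ (e (k + 2)) - ξ (e (k + 3))))]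
    rw [show k + 1 + 2 = k + 3 by ring, show k + 1 + 1 = k + 2 by ring]
    linarith

/-! ### Rates for sequences satisfying a power-type recurrence -/

/-- The finitely many early indices are absorbed into the constant. -/
theorem exists_forall_le_of_eventually {a w : ℕ → ℝ} {k₀ : ℕ} (hw : ∀ k, k₀ ≤ k → 0 < w k) {C : ℝ}
    (h : ∀ᶠ k in atTop, a k ≤ C * w k) : ∃ C' : ℝ, 0 < C' ∧ ∀ k, k₀ ≤ k → a k ≤ C' * w k := by
  obtain ⟨K, hK⟩ := eventually_atTop.1 h
  refine ⟨max C 1 + ∑ k ∈ Finset.range K, |a k / w k|, by positivity, fun k hk => ?_⟩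
  have hwk := hw k hk
  rw [← div_le_iff₀ hwk]
  have hs : 0 ≤ ∑ k ∈ Finset.range K, |a k / w k| := Finset.sum_nonneg fun _ _ => abs_nonneg _
  rcases lt_or_ge k K with hkK | hkK
  · have h1 := Finset.single_le_sum (f := fun k => |a k / w k|) (fun _ _ => abs_nonneg _)
      (Finset.mem_range.2 hkK)
    have h2 := le_abs_self (a k / w k)
    have h3 : 0 < max C 1 := by positivity
    linarith
  · have h1 := (div_le_iff₀ hwk).2 (hK k hkK)
    linarith [le_max_left C 1]

theorem eventually_eq_zero_of_one_le {e : ℕ → ℝ} (he0 : ∀ k, 0 ≤ e k)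
    (het : Tendsto e atTop (𝓝 0)) {M : ℝ}
    (h : ∀ᶠ k in atTop, 0 < e (k + 2) → 1 ≤ M * (e k - e (k + 2))) :
    ∀ᶠ k in atTop, e k = 0 := by
  have h1 : Tendsto (fun k => M * (e k - e (k + 2))) atTop (𝓝 0) := by
    simpa using (het.sub ((tendsto_add_atTop_iff_nat 2).2 het)).const_mul M
  obtain ⟨K, hK⟩ := eventually_atTop.1 (h.and (h1.eventually_lt_const one_pos))
  refine eventually_atTop.2 ⟨K + 2, fun k hk => ?_⟩
  obtain ⟨j, rfl⟩ := Nat.exists_eq_add_of_le' (le_of_add_le_right hk)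
  obtain ⟨h2, h3⟩ := hK j (by omega)
  by_contra hne
  exact absurd (h2 (lt_of_le_of_ne (he0 _) (Ne.symm hne))) (not_le.2 h3)

/-- Once `e ≤ 1`, `q ≤ 1` gives `e (k+2) ≤ e (k+2) ^ q`, so two steps contract by `M / (1 + M)`; `ω`
is its square root. -/
theorem exists_linear_rate {e : ℕ → ℝ} (he0 : ∀ k, 0 ≤ e k) (het : Tendsto e atTop (𝓝 0))
    {M q : ℝ} (hM : 0 < M) (hq : q ≤ 1)
    (h : ∀ᶠ k in atTop, 0 < e (k + 2) → e (k + 2) ^ q ≤ M * (e k - e (k + 2))) :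
    ∃ C ω : ℝ, 0 < ω ∧ ω < 1 ∧ ∀ᶠ k in atTop, e k ≤ C * ω ^ k := by
  set ω := √(M / (1 + M)) with hω
  have hM1 : M / (1 + M) < 1 := by rw [div_lt_one (by positivity)]; linarith
  have hω0 : 0 < ω := by positivity
  have hω2 : ω ^ 2 = M / (1 + M) := Real.sq_sqrt (by positivity)
  have hω1 : ω < 1 := by
    rw [hω, Real.sqrt_lt' one_pos]
    simpa using hM1
  obtain ⟨K, hK⟩ := eventually_atTop.1
    (h.and (((tendsto_add_atTop_iff_nat 2).2 het).eventually_le_const one_pos))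
  have hrec : ∀ k, K ≤ k → e (k + 2) ≤ ω ^ 2 * e k := by
    intro k hk
    obtain ⟨h1, h2⟩ := hK k hk
    rcases (he0 (k + 2)).eq_or_lt with h0 | h0
    · rw [← h0]
      have := he0 k
      positivity
    · have h3 : e (k + 2) ≤ e (k + 2) ^ q := by
        simpa using Real.rpow_le_rpow_of_exponent_ge h0 h2 hq
      have h4 := h3.trans (h1 h0)
      rw [hω2, div_mul_eq_mul_div, le_div_iff₀ (by positivity)]
      linarith
  -- The recurrence has stride two, so the induction carries two consecutive values.
  set C := max (e K / ω ^ K) (e (K + 1) / ω ^ (K + 1)) with hC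
  have key : ∀ j, e (K + j) ≤ C * ω ^ (K + j) ∧ e (K + j + 1) ≤ C * ω ^ (K + j + 1) := by
    intro j
    induction j with
    | zero =>
      exact ⟨(div_le_iff₀ (by positivity)).1 (le_max_left _ _),
        (div_le_iff₀ (by positivity)).1 (le_max_right _ _)⟩
    | succ j ih =>
      refine ⟨ih.2, (hrec (K + j) (by omega)).trans ?_⟩
      calc ω ^ 2 * e (K + j) ≤ ω ^ 2 * (C * ω ^ (K + j)) := by
            have := ih.1
            gcongr
        _ = _ := by ring
  refine ⟨C, ω, hω0, hω1, eventually_atTop.2 ⟨K, fun k hk => ?_⟩⟩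
  obtain ⟨j, rfl⟩ := Nat.exists_eq_add_of_le hk
  exact (key j).1

/-- This is Bernoulli's inequality `(1 + u)^(-r) ≥ 1 - r u` with `u = 2/t`. -/
theorem rpow_neg_sub_rpow_neg_le {r t : ℝ} (hr : 0 < r) (ht : 0 < t) :
    t ^ (-r) - (t + 2) ^ (-r) ≤ 2 * r * t ^ (-(r + 1)) := by
  have h1 : 0 < 1 + 2 / t := by positivity
  have e1 : (t + 2) ^ (-r) = t ^ (-r) * (1 + 2 / t) ^ (-r) := by
    rw [← Real.mul_rpow ht.le h1.le]
    congr 1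
    field_simp
  have h2 : 1 - 2 * r / t ≤ (1 + 2 / t) ^ (-r) := by
    rw [Real.rpow_def_of_pos h1]
    have h3 := Real.add_one_le_exp (Real.log (1 + 2 / t) * -r)
    have h4 := Real.log_le_sub_one_of_pos h1
    have h5 : Real.log (1 + 2 / t) * r ≤ 2 / t * r := by
      gcongr
      linarith
    have h6 : 2 / t * r = 2 * r / t := by ring
    linarith
  have e2 : t ^ (-(r + 1)) = t ^ (-r) / t := by
    rw [neg_add, ← sub_eq_add_neg, Real.rpow_sub_one ht.ne']
  have h7 := mul_le_mul_of_nonneg_left h2 (Real.rpow_nonneg ht.le (-r))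
  rw [e1, e2]
  have h8 : t ^ (-r) * (1 - 2 * r / t) = t ^ (-r) - 2 * r * (t ^ (-r) / t) := by ring
  linarith

/-- The bound `C k^(-r)` propagates by contradiction: with `r q = r + 1`, both sides of the
recurrence scale as `k^(-(r+1))`, so a failure would force `C^(q-1)` below a fixed constant. -/
theorem exists_sublinear_rate {e : ℕ → ℝ} {M q : ℝ} (hM : 0 < M) (hq : 1 < q)
    (h : ∀ᶠ k in atTop, 0 < e (k + 2) → e (k + 2) ^ q ≤ M * (e k - e (k + 2))) :
    ∃ C : ℝ, ∀ᶠ k : ℕ in atTop, e k ≤ C * (k : ℝ) ^ (-(1 / (q - 1))) := by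
  obtain ⟨K0, hK0⟩ := eventually_atTop.1 h
  set K := K0 + 1 with hKdef
  have hq1 : 0 < q - 1 := sub_pos.2 hq
  set r := 1 / (q - 1) with hr
  have hr0 : 0 < r := by positivity
  have hrq : r * q = r + 1 := by rw [hr]; field_simp; ring
  -- The base `3` comes from `k + 2 ≤ 3k` for `k ≥ 1`, ensured by `K = K0 + 1`. Taking `C ≥ A ^ r`
  -- gives `C^(q-1) ≥ A`.
  set A := 2 * M * r * 3 ^ (r + 1) with hA
  have hA0 : 0 < A := by positivity
  set C := max (A ^ r) (max (e K / (K : ℝ) ^ (-r)) (e (K + 1) / ((K + 1 : ℕ) : ℝ) ^ (-r))) with hC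
  have hC0 : 0 < C := lt_max_of_lt_left (by positivity)
  have hrec : ∀ k, K ≤ k → e k ≤ C * (k : ℝ) ^ (-r) →
      e (k + 2) ≤ C * ((k + 2 : ℕ) : ℝ) ^ (-r) := by
    intro k hk hek
    have hkpos : (0 : ℝ) < k := by
      have : 0 < k := by omega
      exact_mod_cast this
    have hk1 : (1 : ℝ) ≤ k := by
      have : 1 ≤ k := by omega
      exact_mod_cast this
    by_contra! hlt
    push_cast at hlt
    have hpos : 0 < C * ((k : ℝ) + 2) ^ (-r) := by positivity
    have h1 := hK0 k (by omega) (hpos.trans hlt)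
    have h2 : (C * ((k : ℝ) + 2) ^ (-r)) ^ q < M * (C * (2 * r * (k : ℝ) ^ (-(r + 1)))) := by
      calc _ < e (k + 2) ^ q := Real.rpow_lt_rpow hpos.le hlt (by linarith)
        _ ≤ M * (e k - e (k + 2)) := h1
        _ ≤ M * (C * (k : ℝ) ^ (-r) - C * ((k : ℝ) + 2) ^ (-r)) := by gcongr
        _ = M * (C * ((k : ℝ) ^ (-r) - ((k : ℝ) + 2) ^ (-r))) := by ring
        _ ≤ _ := by
            have := rpow_neg_sub_rpow_neg_le hr0 hkpos
            gcongr
    have e1 : (C * ((k : ℝ) + 2) ^ (-r)) ^ q = C * C ^ (q - 1) * ((k : ℝ) + 2) ^ (-(r + 1)) := by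
      rw [Real.mul_rpow hC0.le (by positivity), ← Real.rpow_mul (by positivity), neg_mul, hrq,
        Real.rpow_sub_one hC0.ne', mul_div_cancel₀ _ hC0.ne']
    have h3 : (3 * (k : ℝ)) ^ (-(r + 1)) ≤ ((k : ℝ) + 2) ^ (-(r + 1)) :=
      Real.rpow_le_rpow_of_nonpos (by positivity) (by linarith) (by linarith)
    rw [Real.mul_rpow (by norm_num) hkpos.le] at h3
    have h4 : C * C ^ (q - 1) * ((3 : ℝ) ^ (-(r + 1)) * (k : ℝ) ^ (-(r + 1))) <
        M * (C * (2 * r * (k : ℝ) ^ (-(r + 1)))) := by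
      refine lt_of_le_of_lt ?_ h2
      rw [e1]
      gcongr
    have hkr : (0 : ℝ) < (k : ℝ) ^ (-(r + 1)) := by positivity
    have h5 : C ^ (q - 1) * (3 : ℝ) ^ (-(r + 1)) < 2 * M * r := by
      refine lt_of_mul_lt_mul_left ?_ (mul_pos hC0 hkr).le
      calc _ = C * C ^ (q - 1) * ((3 : ℝ) ^ (-(r + 1)) * (k : ℝ) ^ (-(r + 1))) := by ring
        _ < _ := h4
        _ = _ := by ring
    rw [Real.rpow_neg (by norm_num), ← div_eq_mul_inv, div_lt_iff₀ (by positivity)] at h5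
    have h6 : A ≤ C ^ (q - 1) := by
      have h7 : (A ^ r) ^ (q - 1) ≤ C ^ (q - 1) :=
        Real.rpow_le_rpow (by positivity) (le_max_left _ _) hq1.le
      rwa [← Real.rpow_mul hA0.le, hr, one_div_mul_cancel hq1.ne', Real.rpow_one] at h7
    linarith
  have hK1 : (0 : ℝ) < (K : ℝ) := by positivity
  have key : ∀ j, e (K + j) ≤ C * ((K + j : ℕ) : ℝ) ^ (-r) ∧
      e (K + j + 1) ≤ C * ((K + j + 1 : ℕ) : ℝ) ^ (-r) := by
    intro j
    induction j with
    | zero =>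
      exact ⟨(div_le_iff₀ (by positivity)).1 ((le_max_left _ _).trans (le_max_right _ _)),
        (div_le_iff₀ (by positivity)).1 ((le_max_right _ _).trans (le_max_right _ _))⟩
    | succ j ih => exact ⟨ih.2, hrec (K + j) (by omega) ih.1⟩
  refine ⟨C, eventually_atTop.2 ⟨K, fun k hk => ?_⟩⟩
  obtain ⟨j, rfl⟩ := Nat.exists_eq_add_of_le hk
  exact (key j).1

/-- Since `ξ'(s) = c (1 - θ) s^(-θ)`, the KL bound controls `s^θ`; squaring costs the factor `2`
from `(a + b)² ≤ 2 (a² + b²)`. -/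
theorem rpow_two_mul_le_of_kl {c θ M s p q : ℝ} (hs : 0 < s)
    (hp : 0 ≤ p) (hq : 0 ≤ q)
    (h : 1 ≤ deriv (fun t : ℝ => c * t ^ (1 - θ)) s * (M * (√p + √q))) :
    s ^ (2 * θ) ≤ 2 * (c * (1 - θ) * M) ^ 2 * (p + q) := by
  have hd : deriv (fun t : ℝ => c * t ^ (1 - θ)) s = c * ((1 - θ) * s ^ (-θ)) := by
    have h1 := (Real.hasDerivAt_rpow_const (x := s) (p := 1 - θ) (Or.inl hs.ne')).const_mul c
    rw [h1.deriv]
    ring_nf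
  have hsθ : 0 < s ^ θ := Real.rpow_pos_of_pos hs θ
  rw [hd, Real.rpow_neg hs.le] at h
  have h1 : s ^ θ ≤ c * (1 - θ) * M * (√p + √q) := by
    calc s ^ θ ≤ s ^ θ * (c * ((1 - θ) * (s ^ θ)⁻¹) * (M * (√p + √q))) :=
          le_mul_of_one_le_right hsθ.le h
      _ = _ := by field_simp
  have h2 : (√p + √q) ^ 2 ≤ 2 * (p + q) := by
    have := add_sq_le (a := √p) (b := √q)
    rwa [Real.sq_sqrt hp, Real.sq_sqrt hq] at this
  calc s ^ (2 * θ) = (s ^ θ) ^ 2 := by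
        rw [mul_comm, Real.rpow_mul hs.le, Real.rpow_two]
    _ ≤ (c * (1 - θ) * M * (√p + √q)) ^ 2 := pow_le_pow_left₀ hsθ.le h1 2
    _ = (c * (1 - θ) * M) ^ 2 * (√p + √q) ^ 2 := by ring
    _ ≤ (c * (1 - θ) * M) ^ 2 * (2 * (p + q)) := by gcongr
    _ = _ := by ring


/-! ### The merit function along a run -/

/-- By the chain rule each quadratic term contributes at most `(γ/2) · 2 · ρ · 2`, the last factor
bounding the difference of two projections of norm at most one. -/
theorem norm_gradient_chain_le {E V : Type*} [NormedAddCommGroup E] [InnerProductSpace ℝ E]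
    [CompleteSpace E] [NormedAddCommGroup V] [InnerProductSpace ℝ V] [CompleteSpace V]
    {N : ℕ} {γ : ℝ} (hγ : 0 ≤ γ) {F : V → ℝ} (hF : Differentiable ℝ F)
    (pr : Fin (N + 1) → E →L[ℝ] V) (hpr : ∀ i w, ‖pr i w‖ ≤ ‖w‖) (z : E) {ρ : ℝ}
    (hz : ∀ i : Fin N, ‖pr i.castSucc z - pr i.succ z‖ ≤ ρ) :
    ‖gradient (fun y => F (pr 0 y) + γ / 2 * ∑ i : Fin N, ‖pr i.castSucc y - pr i.succ y‖ ^ 2) z‖ ≤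
      ‖gradient F (pr 0 z)‖ + 2 * γ * N * ρ := by
  have h1 : HasFDerivAt (fun y => F (pr 0 y))
      ((InnerProductSpace.toDual ℝ V (gradient F (pr 0 z))).comp (pr 0)) z :=
    (hF (pr 0 z)).hasGradientAt.hasFDerivAt.comp z (pr 0).hasFDerivAt
  have h2 : ∀ i : Fin N, HasFDerivAt (fun y => ‖pr i.castSucc y - pr i.succ y‖ ^ 2)
      (2 • (innerSL ℝ (pr i.castSucc z - pr i.succ z)).comp (pr i.castSucc - pr i.succ)) z :=
    fun i => ((pr i.castSucc - pr i.succ).hasFDerivAt (x := z)).norm_sq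
  have h3 := h1.add
    ((HasFDerivAt.fun_sum fun i (_ : i ∈ Finset.univ) => h2 i).const_mul (γ / 2))
  have h3' := h3.fderiv
  have hsum : 0 ≤ N * ρ := by
    rcases Nat.eq_zero_or_pos N with h | h
    · simp [h]
    · have := (norm_nonneg _).trans (hz ⟨0, h⟩)
      positivity
  rw [gradient, LinearIsometryEquiv.norm_map]
  refine (congrArg norm h3').trans_le ?_
  refine ContinuousLinearMap.opNorm_le_bound _ ?_ fun w => ?_
  · have : 0 ≤ γ * (N * ρ) := mul_nonneg hγ hsum
    have := norm_nonneg (gradient F (pr 0 z))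
    linarith
  · have happ : ((InnerProductSpace.toDual ℝ V (gradient F (pr 0 z))).comp (pr 0) +
        (γ / 2) • ∑ i : Fin N, 2 • (innerSL ℝ (pr i.castSucc z - pr i.succ z)).comp
          (pr i.castSucc - pr i.succ)) w = inner ℝ (gradient F (pr 0 z)) (pr 0 w) +
        γ / 2 * ∑ i : Fin N, 2 * inner ℝ (pr i.castSucc z - pr i.succ z)
          (pr i.castSucc w - pr i.succ w) := by
      simp only [add_apply, smul_apply, sum_apply, ContinuousLinearMap.comp_apply, sub_apply,
        InnerProductSpace.toDual_apply_apply, innerSL_apply_apply, smul_eq_mul, nsmul_eq_mul,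
        Nat.cast_ofNat]
    rw [happ, add_mul]
    refine (norm_add_le _ _).trans (add_le_add ?_ ?_)
    · calc _ ≤ ‖gradient F (pr 0 z)‖ * ‖pr 0 w‖ := norm_inner_le_norm _ _
        _ ≤ _ := by
          have := hpr 0 w
          gcongr
    · have h4 : ∀ i ∈ (Finset.univ : Finset (Fin N)), ‖2 * inner ℝ (pr i.castSucc z - pr i.succ z)
          (pr i.castSucc w - pr i.succ w)‖ ≤ 2 * (ρ * (2 * ‖w‖)) := by
        intro i _
        have h5 : ‖pr i.castSucc w - pr i.succ w‖ ≤ 2 * ‖w‖ :=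
          (norm_sub_le _ _).trans (by linarith [hpr i.castSucc w, hpr i.succ w])
        rw [norm_mul, Real.norm_two]
        gcongr
        exact (norm_inner_le_norm _ _).trans (mul_le_mul (hz i) h5 (norm_nonneg _)
            ((norm_nonneg _).trans (hz i)))
      have h7 := (norm_sum_le _ _).trans (Finset.sum_le_sum h4)
      rw [Finset.sum_const, Finset.card_univ, Fintype.card_fin, nsmul_eq_mul] at h7
      rw [norm_mul, Real.norm_of_nonneg (by positivity)]
      calc _ ≤ γ / 2 * (N * (2 * (ρ * (2 * ‖w‖)))) := by gcongr
        _ = _ := by ring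

theorem norm_gradient_merit_le {n N : ℕ} {γ : ℝ} (hγ : 0 ≤ γ) {F : Vec n → ℝ}
    (hF : Differentiable ℝ F) (z : PiLp 2 (fun _ : Fin (N + 1) => Vec n)) {ρ : ℝ}
    (hz : ∀ i : Fin N, ‖z i.castSucc - z i.succ‖ ≤ ρ) :
    ‖gradient (merit N γ F) z‖ ≤ ‖gradient F (z 0)‖ + 2 * γ * N * ρ :=
  norm_gradient_chain_le hγ hF (fun i => PiLp.proj 2 (fun _ : Fin (N + 1) => Vec n) i)
    (fun i w => PiLp.norm_apply_le w i) z hz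

/-- The point `(x_{kN+N}, …, x_{kN})` at which the merit function is evaluated. -/
noncomputable def window {n : ℕ} (N : ℕ) (x : ℕ → Vec n) (k : ℕ) :
    PiLp 2 (fun _ : Fin (N + 1) => Vec n) :=
  WithLp.toLp 2 (fun i => x (k * N + (N - i)))

theorem merit_window {n N : ℕ} (γ : ℝ) (F : Vec n → ℝ) (x : ℕ → Vec n) (k : ℕ) :
    merit N γ F (window N x k) = F (x (k * N + N)) +
      γ / 2 * ∑ i ∈ Finset.range N, ‖x (k * N + i + 1) - x (k * N + i)‖ ^ 2 := by
  have h : ∑ i : Fin N, ‖window N x k i.castSucc - window N x k i.succ‖ ^ 2 =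
      ∑ i ∈ Finset.range N, ‖x (k * N + i + 1) - x (k * N + i)‖ ^ 2 := by
    rw [← Finset.sum_range_reflect, Finset.sum_range]
    refine Finset.sum_congr rfl fun i _ => ?_
    have hi := i.2
    simp only [window, Fin.val_castSucc, Fin.val_succ]
    rw [show k * N + (N - i) = k * N + (N - 1 - i) + 1 by omega,
      show k * N + (N - (i + 1)) = k * N + (N - 1 - i) by omega]
  rw [merit, h]
  simp [window]

theorem merit_diagPt {n N : ℕ} (γ : ℝ) (F : Vec n → ℝ) (v : Vec n) :
    merit N γ F (diagPt N v) = F v := by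
  simp [merit, diagPt]

theorem exists_radius_of_mem_nhds_diagPt {n N : ℕ} {v : Vec n}
    {V : Set (PiLp 2 (fun _ : Fin (N + 1) => Vec n))} (hV : V ∈ 𝓝 (diagPt N v)) :
    ∃ ρ : ℝ, 0 < ρ ∧ ∀ z : PiLp 2 (fun _ : Fin (N + 1) => Vec n),
      (∀ i, dist (z i) v < ρ) → z ∈ V := by
  have hc : Continuous (fun y : Fin (N + 1) → Vec n =>
      (WithLp.toLp 2 y : PiLp 2 (fun _ : Fin (N + 1) => Vec n))) :=
    PiLp.continuous_toLp 2 _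
  obtain ⟨ρ, hρ, h⟩ := Metric.mem_nhds_iff.1
    (hc.continuousAt.preimage_mem_nhds (x := fun _ => v) hV)
  exact ⟨ρ, hρ, fun z hz => h (a := z.ofLp) ((dist_pi_lt_iff hρ).2 hz)⟩

theorem blockIdx_add_self (N : ℕ) [NeZero N] (k : ℕ) : blockIdx N (k + N) = blockIdx N k := by
  simp [blockIdx, Fin.ext_iff]

theorem blockIdx_mul_add (N : ℕ) [NeZero N] (k : ℕ) (i : Fin N) :
    blockIdx N (k * N + i) = i := by
  simp [blockIdx, Fin.ext_iff, Nat.mod_eq_of_lt i.2]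

/-- The `N - 1` iterations following iteration `k` update other blocks, so the block moved at `k` is
unchanged until its next turn. -/
theorem norm_proj_sub_lagged {n N : ℕ} [NeZero N] (B : Blocks n N) {x : ℕ → Vec n}
    (hx : ∀ k, ∃ v, x (k + 1) = x k + B.embed (blockIdx N k) v) (k : ℕ) :
    ‖B.proj (blockIdx N (k + N)) (x (k + N) - lagged N x (k + N))‖ = ‖x (k + 1) - x k‖ := by
  have hlag : lagged N x (k + N) = x k := by simp [lagged]
  rw [hlag, blockIdx_add_self]
  have h : ∀ j, j < N → B.proj (blockIdx N k) (x (k + 1 + j)) = B.proj (blockIdx N k) (x (k + 1)) := by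
    intro j
    induction j with
    | zero => simp
    | succ j ih =>
      intro hj
      obtain ⟨v, hv⟩ := hx (k + 1 + j)
      have hne : blockIdx N (k + 1 + j) ≠ blockIdx N k := by
        intro he
        have h1 : (k + (j + 1)) % N = (k + 0) % N := by
          have := congrArg Fin.val he
          simpa [blockIdx, add_assoc, add_comm 1 j] using this
        have h2 : j + 1 ≡ 0 [MOD N] := Nat.ModEq.add_left_cancel' k h1
        have h3 := Nat.le_of_dvd (Nat.succ_pos j) ((Nat.modEq_zero_iff_dvd).1 h2)
        omega
      rw [← add_assoc, hv, B.proj_add, B.proj_embed_of_ne hne, add_zero, ih (by omega)]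
  have hN : 0 < N := NeZero.pos N
  have h1 := h (N - 1) (by omega)
  rw [show k + 1 + (N - 1) = k + N by omega] at h1
  obtain ⟨v, hv⟩ := hx k
  rw [B.proj_sub, h1, ← B.proj_sub, hv, add_sub_cancel_left, B.proj_embed, B.norm_embed]


/-! ### Decrease and gradient bounds over a cycle -/

theorem dist_le_mul_of_step_le {n N : ℕ} {x : ℕ → Vec n} {s i j r : ℕ} {d : ℝ} (hd0 : 0 ≤ d)
    (hd : ∀ l, l < N → ‖x (s + l + 1) - x (s + l)‖ ≤ d) (hij : i ≤ j) (hj : j ≤ N)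
    (hr : j - i ≤ r) : dist (x (s + i)) (x (s + j)) ≤ r * d := by
  have h := dist_le_Ico_sum_of_dist_le (f := fun l => x (s + l)) hij (d := fun _ => d)
    (fun {k} _ hk => by
      rw [dist_comm, dist_eq_norm]
      exact hd k (by omega))
  rw [Finset.sum_const, Nat.card_Ico, nsmul_eq_mul] at h
  refine h.trans ?_
  gcongr

/-- Along a run the merit function decreases to the value of the objective at the limit point;
its decrease over a cycle controls the steps and the gradient of the merit function. -/
theorem exists_energy {n N : ℕ} [NeZero N] (B : Blocks n N) {γ : ℝ} (hγ : 0 < γ)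
    {F : Vec n → ℝ} (hF : Differentiable ℝ F) (hF_low : ∃ Flow : ℝ, ∀ v, Flow ≤ F v)
    {x : ℕ → Vec n} {L : ℝ} (hL0 : 0 < L)
    (hL : ∀ j k, ‖gradient F (x j) - gradient F (x k)‖ ≤ L * ‖x j - x k‖)
    {a b : ℝ} (ha : 0 < a) (hb : 0 < b) {H : ℕ → ℝ}
    (hest : ∀ k, 0 ≤ H k ∧ ‖x (k + 1) - x k‖ ≤ b * √(H k) ∧
      F (x (k + 1)) + γ / 2 * ‖x (k + 1) - x k‖ ^ 2 + a * H k ≤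
        F (x k) + γ / 2 * ‖B.proj (blockIdx N k) (x k - lagged N x k)‖ ^ 2 ∧
      ‖B.proj (blockIdx N k) (gradient F (x k))‖ ≤
        b * (√(H k) + ‖B.proj (blockIdx N k) (x k - lagged N x k)‖) ∧
      ∃ v, x (k + 1) = x k + B.embed (blockIdx N k) v)
    {xstar : Vec n} (hxstar : MapClusterPt xstar atTop x) :
    ∃ (e : ℕ → ℝ) (C M : ℝ), 0 < C ∧ 0 < M ∧ Antitone e ∧ (∀ k, 0 ≤ e k) ∧
      Tendsto e atTop (𝓝 0) ∧ (∀ k, merit N γ F (window N x k) = F xstar + e k) ∧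
      (∀ k j, j < N →
        ‖x ((k + 1) * N + j + 1) - x ((k + 1) * N + j)‖ ≤ C * √(e k - e (k + 1))) ∧
      ∀ k, ‖gradient (merit N γ F) (window N x (k + 2))‖ ≤
        M * (√(e (k + 1) - e (k + 2)) + √(e k - e (k + 1))) := by
  obtain ⟨Flow, hFlow⟩ := hF_low
  have hN : 0 < N := NeZero.pos N
  -- `Φ` is the merit value on a window sliding by one iteration. The inertial term at `k + N` is
  -- the oldest squared step, which leaves the window just as the newest enters.
  set Φ : ℕ → ℝ := fun k => F (x (k + N)) +
    γ / 2 * ∑ i ∈ Finset.range N, ‖x (k + i + 1) - x (k + i)‖ ^ 2 with hΦ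
  have hlag := norm_proj_sub_lagged B (fun k => (hest k).2.2.2.2)
  have hdec : ∀ k, Φ (k + 1) + a * H (k + N) ≤ Φ k := by
    intro k
    have h1 := (hest (k + N)).2.2.1
    rw [hlag] at h1
    have h2 := Finset.sum_range_succ (fun i => ‖x (k + i + 1) - x (k + i)‖ ^ 2) N
    have h3 := Finset.sum_range_succ' (fun i => ‖x (k + i + 1) - x (k + i)‖ ^ 2) N
    have h4 : ∑ i ∈ Finset.range N, ‖x (k + 1 + i + 1) - x (k + 1 + i)‖ ^ 2 =
        ∑ i ∈ Finset.range N, ‖x (k + (i + 1) + 1) - x (k + (i + 1))‖ ^ 2 :=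
      Finset.sum_congr rfl fun i _ => by rw [show k + 1 + i = k + (i + 1) by ring]
    simp only [hΦ, h4, add_zero] at h2 h3 ⊢
    rw [show k + 1 + N = k + N + 1 by ring]
    have h5 : ∑ i ∈ Finset.range N, ‖x (k + (i + 1) + 1) - x (k + (i + 1))‖ ^ 2 =
        ∑ i ∈ Finset.range N, ‖x (k + i + 1) - x (k + i)‖ ^ 2 + ‖x (k + N + 1) - x (k + N)‖ ^ 2
        - ‖x (k + 1) - x k‖ ^ 2 := by linarith
    rw [h5]
    linarith
  have hH0 : ∀ k, 0 ≤ H k := fun k => (hest k).1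
  have hanti : Antitone Φ := antitone_nat_of_succ_le fun k => by
    have := mul_nonneg ha.le (hH0 (k + N))
    linarith [hdec k]
  have hΦF : ∀ k, F (x (k + N)) ≤ Φ k := fun k => le_add_of_nonneg_right (by positivity)
  have hbelow : BddBelow (Set.range Φ) := ⟨Flow, by
    rintro _ ⟨k, rfl⟩
    exact (hFlow _).trans (hΦF k)⟩
  set l := ⨅ k, Φ k
  have hlim : Tendsto Φ atTop (𝓝 l) := tendsto_atTop_ciInf hanti hbelow
  have hle : ∀ k, l ≤ Φ k := fun k => ciInf_le hbelow k
  have hHlim : Tendsto H atTop (𝓝 0) := by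
    rw [← tendsto_add_atTop_iff_nat N]
    have h1 : Tendsto (fun k => (Φ k - Φ (k + 1)) / a) atTop (𝓝 0) := by
      simpa using (hlim.sub ((tendsto_add_atTop_iff_nat 1).2 hlim)).div_const a
    refine squeeze_zero (fun k => hH0 _) (fun k => ?_) h1
    rw [le_div_iff₀ ha]
    linarith [hdec k]
  have hstep0 : Tendsto (fun k => ‖x (k + 1) - x k‖) atTop (𝓝 0) := by
    refine squeeze_zero (fun k => norm_nonneg _) (fun k => (hest k).2.1) ?_
    simpa using hHlim.sqrt.const_mul b
  have hFlim : Tendsto (fun k => F (x k)) atTop (𝓝 l) := by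
    rw [← tendsto_add_atTop_iff_nat N]
    have h1 : Tendsto (fun k => ∑ i ∈ Finset.range N, ‖x (k + i + 1) - x (k + i)‖ ^ 2) atTop
        (𝓝 0) := by
      have h2 := tendsto_finsetSum (Finset.range N) fun i _ =>
        ((tendsto_add_atTop_iff_nat i).2 hstep0).pow 2
      simpa using h2
    have h3 := hlim.sub (h1.const_mul (γ / 2))
    simpa [hΦ] using h3
  -- `F` is continuous, so `F xstar` is a cluster value of the convergent sequence `F (x k)`.
  have hFstar : F xstar = l := by
    have h1 : MapClusterPt (F xstar) atTop (fun k => F (x k)) :=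
      hxstar.continuousAt_comp hF.continuous.continuousAt
    exact eq_of_nhds_neBot (ClusterPt.mono h1 hFlim)
  set e : ℕ → ℝ := fun k => Φ (k * N) - l with he
  have heanti : Antitone e := fun i j hij =>
    sub_le_sub_right (hanti (Nat.mul_le_mul_right N hij)) l
  -- The decrease of `Φ` at index `m` is paid by `H (m + N)`, so the decrement over cycle `k`
  -- controls the quantities of cycle `k + 1`.
  have hHe : ∀ k j, j < N → √(H ((k + 1) * N + j)) ≤ √(1 / a) * √(e k - e (k + 1)) := by
    intro k j hj
    rw [← Real.sqrt_mul (by positivity)]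
    refine Real.sqrt_le_sqrt ?_
    rw [one_div, inv_mul_eq_div, le_div_iff₀ ha]
    have h1 := hdec (k * N + j)
    have h2 : Φ (k * N + j) ≤ Φ (k * N) := hanti (by omega)
    have h3 : Φ ((k + 1) * N) ≤ Φ (k * N + j + 1) := hanti (by rw [add_mul]; omega)
    rw [show (k + 1) * N + j = k * N + j + N by ring]
    simp only [he]
    linarith
  set C : ℝ := b * √(1 / a) with hC
  have hC0 : 0 < C := by positivity
  have hCstep : ∀ k j, j < N →
      ‖x ((k + 1) * N + j + 1) - x ((k + 1) * N + j)‖ ≤ C * √(e k - e (k + 1)) := fun k j hj => by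
    refine (hest _).2.1.trans ?_
    rw [hC, mul_assoc]
    have := hHe k j hj
    gcongr
  set M1 : ℝ := b * √(1 / a) + b * C + L * (N * C) with hM1
  have hM10 : 0 < M1 := by positivity
  have hgrad : ∀ k, ‖gradient F (x ((k + 2) * N + N))‖ ≤
      N * (M1 * (√(e (k + 1) - e (k + 2)) + √(e k - e (k + 1)))) := by
    intro k
    set R1 := √(e (k + 1) - e (k + 2)) with hR1
    set R0 := √(e k - e (k + 1)) with hR0
    have hR1n : 0 ≤ R1 := Real.sqrt_nonneg _
    have hR0n : 0 ≤ R0 := Real.sqrt_nonneg _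
    refine B.norm_le_of_proj_le _ (by positivity) fun i => ?_
    -- The partial gradient of block `i` is estimated when that block is updated, then carried to
    -- the end of the cycle. Its inertial part is a step of the previous cycle, hence the second
    -- decrement.
    have h1 := (hest ((k + 2) * N + i)).2.2.2.1
    rw [blockIdx_mul_add] at h1
    have h2 : ‖B.proj i (x ((k + 2) * N + i) - lagged N x ((k + 2) * N + i))‖ ≤ C * R0 := by
      have h3 := hlag ((k + 1) * N + i)
      rw [show (k + 1) * N + i + N = (k + 2) * N + i by ring, blockIdx_mul_add] at h3
      rw [h3]
      exact hCstep k i i.2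
    have h4 : ‖gradient F (x ((k + 2) * N + N)) - gradient F (x ((k + 2) * N + i))‖ ≤
        L * (N * (C * R1)) := by
      refine (hL _ _).trans ?_
      rw [← dist_eq_norm, dist_comm]
      have := dist_le_mul_of_step_le (N := N) (s := (k + 2) * N) (r := N) (by positivity)
        (hCstep (k + 1)) i.2.le le_rfl (Nat.sub_le _ _)
      gcongr
    have h5 : B.proj i (gradient F (x ((k + 2) * N + N))) =
        B.proj i (gradient F (x ((k + 2) * N + i))) +
        B.proj i (gradient F (x ((k + 2) * N + N)) - gradient F (x ((k + 2) * N + i))) := by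
      rw [B.proj_sub]
      abel
    rw [h5]
    have h6 := hHe (k + 1) i i.2
    calc _ ≤ _ := norm_add_le _ _
      _ ≤ b * (√(1 / a) * R1 + C * R0) + L * (N * (C * R1)) := by
          refine add_le_add (h1.trans ?_) ((B.norm_proj_le _ _).trans h4)
          gcongr
      _ ≤ M1 * (R1 + R0) := by
          have e1 : M1 * (R1 + R0) = b * (√(1 / a) * R1 + C * R0) + L * (N * (C * R1)) +
              (b * √(1 / a) * R0 + b * C * R1 + L * (N * C) * R0) := by rw [hM1]; ring
          rw [e1]
          exact le_add_of_nonneg_right (by positivity)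
  have hmerit : ∀ k, merit N γ F (window N x k) = F xstar + e k := fun k => by
    rw [merit_window, hFstar, he]
    simp only [hΦ]
    ring
  refine ⟨e, C, N * M1 + 2 * γ * N * C, hC0, by positivity, heanti, fun k => sub_nonneg.2 (hle _),
    ?_, hmerit, hCstep, fun k => ?_⟩
  · have h1 := (hlim.comp (tendsto_id.atTop_mul_const' hN)).sub_const l
    simpa [he] using h1
  · set R1 := √(e (k + 1) - e (k + 2)) with hR1
    set R0 := √(e k - e (k + 1)) with hR0
    have hR0n : 0 ≤ R0 := Real.sqrt_nonneg _
    have h1 := norm_gradient_merit_le hγ.le hF (window N x (k + 2)) (ρ := C * R1) fun i => by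
      have hi := i.2
      have h2 := hCstep (k + 1) (N - 1 - i) (by omega)
      have e1 : window N x (k + 2) i.castSucc = x ((k + 1 + 1) * N + (N - 1 - i) + 1) := by
        simp only [window, Fin.val_castSucc]
        congr 1
        rw [show k + 1 + 1 = k + 2 by ring]
        omega
      have e2 : window N x (k + 2) i.succ = x ((k + 1 + 1) * N + (N - 1 - i)) := by
        simp only [window, Fin.val_succ]
        congr 1
        rw [show k + 1 + 1 = k + 2 by ring]
        omega
      rw [e1, e2]
      exact h2
    have e0 : window N x (k + 2) 0 = x ((k + 2) * N + N) := by simp [window]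
    rw [e0] at h1
    refine h1.trans ((add_le_add_left (hgrad k) _).trans ?_)
    have h3 : 0 ≤ 2 * γ * N * C * R0 := by positivity
    linarith


/-! ### Convergence from the KL inequality -/

/-- A sequence is controlled by its values at the ends of the cycles. -/
theorem eventually_dist_cycle_end_lt {n N : ℕ} {x : ℕ → Vec n} {R : ℕ → ℝ}
    (hR0 : ∀ k, 0 ≤ R k) (hR : Tendsto R atTop (𝓝 0))
    (hx : ∀ k j, j < N → ‖x ((k + 1) * N + j + 1) - x ((k + 1) * N + j)‖ ≤ R k) {ε : ℝ}
    (hε : 0 < ε) :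
    ∀ᶠ k in atTop, ∀ j, j ≤ N → dist (x ((k + 1) * N + j)) (x ((k + 1) * N + N)) < ε := by
  have h : Tendsto (fun k => (N : ℝ) * R k) atTop (𝓝 0) := by simpa using hR.const_mul (N : ℝ)
  filter_upwards [h.eventually_lt_const hε] with k hk j hj
  exact (dist_le_mul_of_step_le (hR0 k) (hx k) hj le_rfl (Nat.sub_le _ _)).trans_lt hk

theorem tendsto_and_recurrence_of_kl {n N : ℕ} (hN : 0 < N) {γ : ℝ} {F : Vec n → ℝ}
    {x : ℕ → Vec n} {xstar : Vec n} (hxstar : MapClusterPt xstar atTop x)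
    {e : ℕ → ℝ} {C M : ℝ} (hC : 0 < C) (hM : 0 < M) (he : Antitone e) (he0 : ∀ k, 0 ≤ e k)
    (het : Tendsto e atTop (𝓝 0)) (hmerit : ∀ k, merit N γ F (window N x k) = F xstar + e k)
    (hstep : ∀ k j, j < N →
      ‖x ((k + 1) * N + j + 1) - x ((k + 1) * N + j)‖ ≤ C * √(e k - e (k + 1)))
    (hgrad : ∀ k, ‖gradient (merit N γ F) (window N x (k + 2))‖ ≤
        M * (√(e (k + 1) - e (k + 2)) + √(e k - e (k + 1))))
    {ξ : ℝ → ℝ} (hKL : KLAtWith (merit N γ F) (diagPt N xstar) ξ) :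
    Tendsto x atTop (𝓝 xstar) ∧ ∀ᶠ k in atTop, 0 < e (k + 2) →
      1 ≤ deriv ξ (e (k + 2)) * (M * (√(e (k + 1) - e (k + 2)) + √(e k - e (k + 1)))) := by
  obtain ⟨ν, hν, hξ, V, hV, hKL⟩ := hKL
  obtain ⟨ρ, hρ, hρV⟩ := exists_radius_of_mem_nhds_diagPt hV
  have hsh : ∀ j, Tendsto (fun k => e (k + j)) atTop (𝓝 0) := fun j =>
    (tendsto_add_atTop_iff_nat j).2 het
  have hRlim : Tendsto (fun k => C * √(e k - e (k + 1))) atTop (𝓝 0) := by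
    simpa using (het.sub (hsh 1)).sqrt.const_mul C
  have hnear := fun {ε : ℝ} (hε : 0 < ε) =>
    eventually_dist_cycle_end_lt (fun k => by positivity) hRlim hstep hε
  set u : ℕ → Vec n := fun k => x ((k + 2) * N + N) with hu
  -- Half of the radius is for the end of the cycle and half for the rest of its window.
  have hloc : ∀ᶠ k in atTop, dist (u k) xstar < ρ / 2 → 0 < e (k + 2) →
      1 ≤ deriv ξ (e (k + 2)) * (M * (√(e (k + 1) - e (k + 2)) + √(e k - e (k + 1)))) := by
    filter_upwards [(tendsto_add_atTop_nat 1).eventually (hnear (half_pos hρ)),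
      (hsh 2).eventually_lt_const hν] with k hk hkν hdist hpos
    have hmem : window N x (k + 2) ∈ V := by
      refine hρV _ fun i => ?_
      have h1 := hk (N - i) (Nat.sub_le _ _)
      have h2 := dist_triangle (x ((k + 2) * N + (N - i))) (u k) xstar
      have h3 : window N x (k + 2) i = x ((k + 2) * N + (N - i)) := rfl
      rw [h3]
      rw [show k + 1 + 1 = k + 2 by ring] at h1
      simp only [hu] at h2 hdist
      linarith
    have h1 := hKL _ hmem
    rw [hmerit, merit_diagPt, add_sub_cancel_left] at h1
    refine (h1 (by linarith) (by linarith)).trans ?_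
    have h2 := hξ.deriv_pos _ ⟨hpos, hkν⟩
    have h3 := hgrad k
    gcongr
  have hdiv : Tendsto (fun m : ℕ => m / N) atTop atTop := Nat.tendsto_div_const_atTop hN.ne'
  -- Iterate `m` lies in cycle `m / N`, whose end is `u (m / N - 2)` once `m / N ≥ 2`.
  have hclose : ∀ {ε : ℝ}, 0 < ε → ∀ᶠ m in atTop, dist (x m) (u (m / N - 2)) < ε := by
    intro ε hε
    filter_upwards [((tendsto_sub_atTop_nat 1).comp hdiv).eventually (hnear hε),
      hdiv.eventually_ge_atTop 2] with m hm hm2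
    have h1 := hm (m % N) (Nat.mod_lt _ hN).le
    simp only [Function.comp_apply] at h1
    rw [show m / N - 1 + 1 = m / N by omega, Nat.div_add_mod'] at h1
    simpa only [hu, show m / N - 2 + 2 = m / N by omega] using h1
  have hdiv2 : Tendsto (fun m : ℕ => m / N - 2) atTop atTop := (tendsto_sub_atTop_nat 2).comp hdiv
  obtain ⟨W, hW0, hWt, hW⟩ := exists_lyapunov_of_kl he he0 het hν hM hξ hloc
  have hutend : Tendsto u atTop (𝓝 xstar) := by
    have hNC : 0 < N * C := by positivity
    refine tendsto_of_lyapunov (V := fun k => N * C * W k) ?_ ?_ (half_pos hρ) ?_ ?_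
    · filter_upwards [hW0] with k hk using mul_nonneg hNC.le hk
    · simpa using hWt.const_mul (N * C)
    · filter_upwards [hW] with k hk hd
      have h1 := dist_le_mul_of_step_le (N := N) (s := (k + 3) * N) (i := 0) (r := N)
        (by positivity) (hstep (k + 2)) (Nat.zero_le _) le_rfl (Nat.sub_le _ _)
      rw [dist_comm] at h1
      have e1 : u k = x ((k + 3) * N + 0) := by
        simp only [hu]
        congr 1
        ring
      have e2 : u (k + 1) = x ((k + 3) * N + N) := rfl
      rw [e1, e2, ← mul_sub]
      refine h1.trans ?_
      rw [← mul_assoc]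
      have := hk hd
      gcongr
    · intro ε hε
      have h1 : ∃ᶠ m in atTop, dist (x m) xstar < ε / 2 :=
        hxstar.frequently (Metric.ball_mem_nhds _ (half_pos hε))
      have h2 : ∃ᶠ m in atTop, dist (u (m / N - 2)) xstar < ε := by
        refine (h1.and_eventually (hclose (half_pos hε))).mono fun m hm => ?_
        have h3 := dist_triangle_left (u (m / N - 2)) xstar (x m)
        linarith [hm.1, hm.2]
      exact hdiv2.frequently h2
  refine ⟨?_, ?_⟩
  · refine (hutend.comp hdiv2).congr_dist ?_
    rw [Metric.tendsto_nhds]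
    intro ε hε
    filter_upwards [hclose hε] with m hm
    rw [Real.dist_0_eq_abs, abs_of_nonneg dist_nonneg, dist_comm]
    exact hm
  · filter_upwards [hloc, hutend.eventually (Metric.ball_mem_nhds _ (half_pos hρ))] with k hk hd
      using hk hd

end BlockPHILA

/-! ### Convergence and the three rates -/

theorem mainTheorem3
    (n N : ℕ) [NeZero N] (B : BlockPHILA.Blocks n N) (p : BlockPHILA.Params)
    (f φ : BlockPHILA.Vec n → ℝ)
    (hf : ContDiff ℝ 1 f)
    (hφ_conv : ∀ (i : Fin N) (v : BlockPHILA.Vec n),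
      ConvexOn ℝ Set.univ (B.restrict φ i v))
    (hF_low : ∃ Flow : ℝ, ∀ v, Flow ≤ f v + φ v)
    (hf_lip : ∃ Lf : ℝ, 0 < Lf ∧ ∀ u v, ‖gradient f u - gradient f v‖ ≤ Lf * ‖u - v‖)
    (hφ : ContDiff ℝ 1 φ)
    (hφ_lip : ∀ K : Set (BlockPHILA.Vec n), IsCompact K → ∃ Lφ : ℝ, 0 < Lφ ∧
      ∀ u ∈ K, ∀ v ∈ K, ‖gradient φ u - gradient φ v‖ ≤ Lφ * ‖u - v‖)
    (x : ℕ → BlockPHILA.Vec n) (α β : ℕ → ℝ)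
    (D : (k : ℕ) → Matrix (Fin (B.size (BlockPHILA.blockIdx N k)))
      (Fin (B.size (BlockPHILA.blockIdx N k))) ℝ)
    (ytil : (k : ℕ) → BlockPHILA.Vec (B.size (BlockPHILA.blockIdx N k))) (m : ℕ → ℕ)
    (hrun : BlockPHILA.IsRun B p f φ x α β D ytil m)
    (hbdd : Bornology.IsBounded (Set.range x))
    (hKL : BlockPHILA.IsKLFunction (BlockPHILA.liftSq (fun v => f v + φ v)))
    (xstar : BlockPHILA.Vec n) (hxstar : MapClusterPt xstar atTop x)
    (c θ : ℝ) (hc : 0 < c) (hθ : θ ∈ Set.Ico (0 : ℝ) 1)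
    (hKLΨ : BlockPHILA.KLAtWith (BlockPHILA.merit N p.γ (fun v => f v + φ v))
      (BlockPHILA.diagPt N xstar) (fun t => c * t ^ (1 - θ))) :
    Tendsto x atTop (𝓝 xstar) ∧
    (θ = 0 → ∃ K : ℕ, ∀ k, K ≤ k → x k = xstar) ∧
    (θ ∈ Set.Ioc (0 : ℝ) (1 / 2) → ∃ C ω : ℝ, 0 < C ∧ 0 < ω ∧ ω < 1 ∧
      ∀ k : ℕ, (f (x (k * N)) + φ (x (k * N))) - (f xstar + φ xstar) ≤ C * ω ^ k) ∧
    (θ ∈ Set.Ioo (1 / 2 : ℝ) 1 → ∃ C : ℝ, 0 < C ∧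
      ∀ k : ℕ, 1 ≤ k → (f (x (k * N)) + φ (x (k * N))) - (f xstar + φ xstar) ≤
        C * (k : ℝ) ^ (-(1 / (2 * θ - 1)))) := by
  have hfd := hf.differentiable one_ne_zero
  have hφd := hφ.differentiable one_ne_zero
  have hN : 0 < N := NeZero.pos N
  obtain ⟨L, hL0, hL⟩ :=
    BlockPHILA.exists_lipschitz_gradient_of_isBounded hfd hφd hf_lip hφ_lip hbdd
  obtain ⟨a, b, ha, hb, H, hest⟩ := BlockPHILA.exists_step_estimates B p f φ hfd hφ_conv hF_low
    hf_lip hφd hφ_lip x α β D ytil m hrun hbdd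
  obtain ⟨e, C, M, hC, hM, he, he0, het, hmerit, hstep, hgrad⟩ :=
    BlockPHILA.exists_energy B p.γ_pos (F := fun v => f v + φ v) (hfd.add hφd) hF_low hL0
      (fun j k => hL _ ⟨j, rfl⟩ _ ⟨k, rfl⟩) ha hb hest hxstar
  obtain ⟨hlim, hrec⟩ := BlockPHILA.tendsto_and_recurrence_of_kl hN hxstar hC hM he he0 het hmerit
    hstep hgrad hKLΨ
  set M' := 2 * (c * (1 - θ) * M) ^ 2 with hM'
  have hθ1 : 0 < 1 - θ := sub_pos.2 hθ.2
  have hM'0 : 0 < M' := by positivity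
  have hpow : ∀ᶠ k in atTop, 0 < e (k + 2) → e (k + 2) ^ (2 * θ) ≤ M' * (e k - e (k + 2)) := by
    filter_upwards [hrec] with k hk hpos
    have h := BlockPHILA.rpow_two_mul_le_of_kl hpos
      (sub_nonneg.2 (he (Nat.le_succ (k + 1)))) (sub_nonneg.2 (he (Nat.le_succ k))) (hk hpos)
    rwa [show e (k + 1) - e (k + 1).succ + (e k - e k.succ) = e k - e (k + 2) by
      simp only [Nat.succ_eq_add_one]; ring] at h
  -- Window `k` ends at `x ((k + 1) * N)`, so the objective gap lags `e` by one cycle.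
  have hFe : ∀ k, (f (x ((k + 1) * N)) + φ (x ((k + 1) * N))) - (f xstar + φ xstar) ≤ e k := by
    intro k
    have h1 := hmerit k
    rw [BlockPHILA.merit_window] at h1
    have h2 : 0 ≤ p.γ / 2 * ∑ i ∈ Finset.range N, ‖x (k * N + i + 1) - x (k * N + i)‖ ^ 2 := by
      have := p.γ_pos
      positivity
    rw [add_one_mul]
    linarith
  refine ⟨hlim, fun h0 => ?_, fun h => ?_, fun h => ?_⟩
  · have h1 : ∀ᶠ k in atTop, e k = 0 := by
      refine BlockPHILA.eventually_eq_zero_of_one_le he0 het (M := M') ?_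
      filter_upwards [hpow] with k hk hpos
      simpa [h0] using hk hpos
    obtain ⟨K, hK⟩ := eventually_atTop.1 h1
    -- Once `e` vanishes, so do its decrements and with them all later steps.
    have hconst : ∀ m, (K + 1) * N ≤ m → x (m + 1) = x m := by
      intro m hm
      have hq : K + 1 ≤ m / N := (Nat.le_div_iff_mul_le hN).2 hm
      have h2 := hstep (m / N - 1) (m % N) (Nat.mod_lt _ hN)
      rw [hK _ (by omega), hK _ (by omega), sub_self, Real.sqrt_zero, mul_zero,
        show m / N - 1 + 1 = m / N by omega, Nat.div_add_mod'] at h2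
      exact sub_eq_zero.1 (norm_le_zero_iff.1 h2)
    refine ⟨(K + 1) * N, fun k hk => ?_⟩
    have h3 : ∀ m, k ≤ m → x m = x k := fun m hm => by
      induction m, hm using Nat.le_induction with
      | base => rfl
      | succ m hm ih => rw [hconst m (hk.trans hm), ih]
    exact tendsto_nhds_unique (tendsto_const_nhds.congr' (by
      filter_upwards [eventually_ge_atTop k] with m hm using (h3 m hm).symm)) hlim
  · obtain ⟨C', ω, hω0, hω1, hC'⟩ := BlockPHILA.exists_linear_rate he0 het hM'0
      (by linarith [h.2]) hpow
    -- Dividing by `ω` compensates for the lag of one cycle.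
    obtain ⟨C'', hC''0, hC''⟩ := BlockPHILA.exists_forall_le_of_eventually (k₀ := 0)
      (a := fun k => (f (x (k * N)) + φ (x (k * N))) - (f xstar + φ xstar)) (w := fun k => ω ^ k)
      (C := C' / ω) (fun k _ => by positivity) (by
        obtain ⟨K, hK⟩ := eventually_atTop.1 hC'
        refine eventually_atTop.2 ⟨K + 1, fun k hk => ?_⟩
        obtain ⟨j, rfl⟩ := Nat.exists_eq_add_of_le' (le_of_add_le_right hk)
        refine (hFe j).trans ((hK j (by omega)).trans_eq ?_)
        rw [pow_succ]
        field_simp)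
    exact ⟨C'', ω, hC''0, hω0, hω1, fun k => hC'' k (Nat.zero_le k)⟩
  · obtain ⟨C', hC'⟩ := BlockPHILA.exists_sublinear_rate hM'0 (by linarith [h.1]) hpow
    set r := 1 / (2 * θ - 1) with hr
    have hr0 : 0 < r := one_div_pos.2 (by linarith [h.1])
    -- The lag of one cycle costs `2 ^ r`, because `j ≥ (j + 1) / 2` for `j ≥ 1`; starting at `K +
    -- 2` ensures this. The absolute value covers a negative `C'`.
    exact BlockPHILA.exists_forall_le_of_eventually (k₀ := 1)
      (a := fun k => (f (x (k * N)) + φ (x (k * N))) - (f xstar + φ xstar))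
      (w := fun k => (k : ℝ) ^ (-r)) (C := |C'| * 2 ^ r)
      (fun k hk => Real.rpow_pos_of_pos (by exact_mod_cast hk) _) (by
        obtain ⟨K, hK⟩ := eventually_atTop.1 hC'
        refine eventually_atTop.2 ⟨K + 2, fun k hk => ?_⟩
        obtain ⟨j, rfl⟩ := Nat.exists_eq_add_of_le' (show 1 ≤ k by omega)
        have hj : (1 : ℝ) ≤ j := by
          have : 1 ≤ j := by omega
          exact_mod_cast this
        have h1 : (j : ℝ) ^ (-r) ≤ (((j + 1 : ℕ) : ℝ) / 2) ^ (-r) :=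
          Real.rpow_le_rpow_of_nonpos (by positivity) (by push_cast; linarith) (by linarith)
        rw [Real.div_rpow (by positivity) (by norm_num), Real.rpow_neg (by norm_num : (0 : ℝ) ≤ 2),
          div_inv_eq_mul] at h1
        calc _ ≤ C' * (j : ℝ) ^ (-r) := (hFe j).trans (hK j (by omega))
          _ ≤ |C'| * (j : ℝ) ^ (-r) := by
            gcongr
            exact le_abs_self C'
          _ ≤ |C'| * (((j + 1 : ℕ) : ℝ) ^ (-r) * 2 ^ r) := by gcongr
          _ = _ := by ring)
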